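/- For a sequence $x=(x_n)_{n\ge 1}$ in $[0,1)$ (identified with the torus $\mathbf{R}/\mathbf{Z}$), let $|z|$ denote the distance from $z \in \mathbf{R}$ to the nearest integer, and for a positive integer $N$ and a real $s>0$ let $$F_{x,N}(s)=\frac1N\,\#\Big\{(i,j): 1\le i\neq j\le N,\ |x_i-x_j|<\frac sN\Big\}.$$ The sequence has Poissonian pair correlations if $\lim_{N\to\infty}F_{x,N}(s)=2s$ for every real $s>0$. Let $g(N)$ be the number of distinct gap lengths between neighboring elements of $x_1,\dots,x_N$, that is, the number of distinct values $|x_{\sigma(k+1)}-x_{\sigma(k)}|$, $1\le k\le N$, where $\sigma$ is a permutation of $\{1,\dots,N\}$ with $x_{\sigma(1)}\le\cdots\le x_{\sigma(N)}$ and $\sigma(N+1):=\sigma(1)$. Theorem. Let $f:\mathbf{N}^+\to\mathbf{N}^+$ be any function with $\lim_{n\to\infty}f(n)=\infty$. Then there exists a sequence $(x_n)$ in $[0,1)$ with Poissonian pair correlations such that $g(n)\le f(n)$ for all sufficiently large $n$. -/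

import Mathlib

open Filter Topology

/-- Distance of a real number from the nearest integer, i.e. the norm of its class in `ℝ / ℤ`. -/
noncomputable def torusNorm (z : ℝ) : ℝ := ‖(z : UnitAddCircle)‖

theorem torusNorm_eq_min {z : ℝ} (hz : z ∈ Set.Ico (0 : ℝ) 1) : torusNorm z = min z (1 - z) := by
  rw [torusNorm, UnitAddCircle.norm_eq, abs_sub_round_eq_min, Int.fract_eq_self.2 hz]

/-- `F_{x,N}(s)`: the number of ordered pairs `1 ≤ i ≠ j ≤ N` such that the torus distance of
`x i` and `x j` is less than `s / N`, divided by `N`. -/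
noncomputable def pairCorrelation (x : ℕ+ → ℝ) (N : ℕ+) (s : ℝ) : ℝ :=
  (Set.ncard {p : ℕ+ × ℕ+ | p.1 ≤ N ∧ p.2 ≤ N ∧ p.1 ≠ p.2 ∧
    torusNorm (x p.1 - x p.2) < s / (N : ℝ)} : ℝ) / (N : ℝ)

theorem pairCorrelation_finite (x : ℕ+ → ℝ) (N : ℕ+) (s : ℝ) :
    {p : ℕ+ × ℕ+ | p.1 ≤ N ∧ p.2 ≤ N ∧ p.1 ≠ p.2 ∧
      torusNorm (x p.1 - x p.2) < s / (N : ℝ)}.Finite :=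
  ((Set.finite_Iic N).prod (Set.finite_Iic N)).subset fun _ hp => ⟨hp.1, hp.2.1⟩

/-- The sequence has Poissonian pair correlations. -/
def HasPoissonianPairCorrelations (x : ℕ+ → ℝ) : Prop :=
  ∀ s : ℝ, 0 < s → Tendsto (fun N : ℕ+ => pairCorrelation x N s) atTop (𝓝 (2 * s))

/-- The first `N` terms of the sequence; index `k : Fin N` stands for the term of index `k + 1`. -/
def initialTerms (x : ℕ+ → ℝ) (N : ℕ+) (k : Fin (N : ℕ)) : ℝ := x (Nat.succPNat (k : ℕ))

/-- The set of gap lengths between neighbouring elements of the first `N` terms: arrange the terms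
in weakly increasing order by a permutation `σ` and take the torus distances of cyclically
consecutive terms (`finRotate` sends each index to the next one, and the last to the first). -/
def gapSet (x : ℕ+ → ℝ) (N : ℕ+) : Set ℝ :=
  {r : ℝ | ∃ σ : Equiv.Perm (Fin (N : ℕ)), Monotone (initialTerms x N ∘ σ) ∧
    ∃ k : Fin (N : ℕ),
      r = torusNorm (initialTerms x N (σ (finRotate (N : ℕ) k)) - initialTerms x N (σ k))}

/-- The set of gap lengths may be computed from any one sorting permutation. -/
theorem gapSet_eq (x : ℕ+ → ℝ) (N : ℕ+) (σ : Equiv.Perm (Fin (N : ℕ)))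
    (hσ : Monotone (initialTerms x N ∘ σ)) :
    gapSet x N = Set.range fun k : Fin (N : ℕ) =>
      torusNorm (initialTerms x N (σ (finRotate (N : ℕ) k)) - initialTerms x N (σ k)) := by
  ext r
  constructor
  · rintro ⟨τ, hτ, k, rfl⟩
    have h : initialTerms x N ∘ τ = initialTerms x N ∘ σ := Tuple.unique_monotone hτ hσ
    have h' : ∀ j, initialTerms x N (τ j) = initialTerms x N (σ j) := congrFun h
    exact ⟨k, by simp only [h']⟩
  · rintro ⟨k, rfl⟩
    exact ⟨σ, hσ, k, rfl⟩

theorem gapSet_finite (x : ℕ+ → ℝ) (N : ℕ+) : (gapSet x N).Finite := by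
  rw [gapSet_eq x N _ (Tuple.monotone_sort (initialTerms x N))]
  exact Set.finite_range _

/-- `g(N)`: the number of distinct gap lengths between neighbours among the first `N` terms. -/
noncomputable def gapCount (x : ℕ+ → ℝ) (N : ℕ+) : ℕ := (gapSet x N).ncard

/-! The sequence is built deterministically on dyadic grids. The terms with indices from `2 ^ k` to
`2 ^ (k + 1)` form `m = 2 ^ e k` layers of `R = 2 ^ k / m` points, one in each of the `R` cells of
length `1 / R`. A cell has `E = 2 * K * m` grid positions, `K = m ^ 2`, of which each layer may use
`K` equally spaced ones, disjoint from those of the other layers.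

A random choice of site would produce the expected number of close pairs. It is derandomized by
locality: at the scales considered, the number of older points close to a site depends only on the
occupancy pattern of the cell and its two neighbours. There are at most `2 ^ (3 * E)` patterns, and
cells of equal pattern take the `K` sites in rotation, so the total differs from the average over
sites by a constant depending on `m` alone (`abs_sum_roundRobin_sub_le`, `exists_layer`). If `e`
grows slowly, this is negligible. Summing over layers and blocks, and interpolating by monotonicity,
gives `tendsto_closePairs_div`.

Gaps are multiples of the mesh `1 / G` and at most `2 / R`, since every cell is occupied; hence only
`2 * G / R + 1` values are possible, a number controlled by `e` (`gapCount_le`). Letting `e` tend to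
infinity slowly enough keeps it below `f`. -/

/-! ### Torus distance and equally spaced points -/

theorem torusNorm_lt_iff {z w : ℝ} : torusNorm z < w ↔ ∃ n : ℤ, |z - n| < w := by
  rw [torusNorm, UnitAddCircle.norm_eq]
  exact ⟨fun h => ⟨round z, h⟩, fun ⟨n, hn⟩ => (round_le z n).trans_lt hn⟩

theorem torusNorm_neg (z : ℝ) : torusNorm (-z) = torusNorm z := by
  simp [torusNorm]

theorem torusNorm_sub_comm (x y : ℝ) : torusNorm (x - y) = torusNorm (y - x) := by
  rw [← torusNorm_neg, neg_sub]

theorem torusNorm_le_abs_sub (z : ℝ) (n : ℤ) : torusNorm z ≤ |z - n| := by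
  rw [torusNorm, UnitAddCircle.norm_eq]
  exact round_le z n

/-- The number of integers in an open interval of length `2 * r`. -/
theorem card_Ioo_floor_ceil (c r : ℝ) (hr : 0 ≤ r) :
    2 * r - 1 ≤ ((Finset.Ioo ⌊c - r⌋ ⌈c + r⌉).card : ℝ) ∧
      ((Finset.Ioo ⌊c - r⌋ ⌈c + r⌉).card : ℝ) ≤ 2 * r + 1 := by
  have h1 := Int.floor_le (c - r)
  have h2 := Int.lt_floor_add_one (c - r)
  have h3 := Int.le_ceil (c + r)
  have h4 := Int.ceil_lt_add_one (c + r)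
  rw [Int.card_Ioo]
  by_cases h : 0 ≤ ⌈c + r⌉ - ⌊c - r⌋ - 1
  · have : (((⌈c + r⌉ - ⌊c - r⌋ - 1).toNat : ℤ) : ℝ) = ⌈c + r⌉ - ⌊c - r⌋ - 1 := by
      rw [Int.toNat_of_nonneg h]; push_cast; ring
    rw [Int.cast_natCast] at this
    rw [this]
    constructor <;> linarith
  · have h5 : (⌈c + r⌉ - ⌊c - r⌋ - 1).toNat = 0 := Int.toNat_of_nonpos (by omega)
    have h6 : (⌈c + r⌉ : ℝ) - ⌊c - r⌋ - 1 ≤ -1 := by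
      have : ⌈c + r⌉ - ⌊c - r⌋ - 1 ≤ -1 := by omega
      exact_mod_cast this
    rw [h5]
    push_cast
    constructor <;> linarith

theorem mem_Ioo_floor_ceil {c r : ℝ} {z : ℤ} :
    z ∈ Finset.Ioo ⌊c - r⌋ ⌈c + r⌉ ↔ |c - z| < r := by
  rw [Finset.mem_Ioo, Int.floor_lt, Int.lt_ceil, abs_lt]
  constructor <;> rintro ⟨h1, h2⟩ <;> constructor <;> linarith

open Classical in
/-- An arc of radius `w` contains `2 * w * M + O(1)` of the `M` equally spaced points `b / M`. -/
theorem card_equispaced_near (M : ℕ) (hM : 0 < M) (c w : ℝ) (hw : 0 ≤ w) (hw2 : 2 * w ≤ 1) :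
    |(((Finset.range M).filter fun b : ℕ => torusNorm (c - b / M) < w).card : ℝ) - 2 * w * M|
      ≤ 1 := by
  have hM' : (0 : ℝ) < M := by exact_mod_cast hM
  have key : ∀ (b : ℕ) (n : ℤ), |c - b / M - n| < w ↔ |c * M - ((b + n * M : ℤ) : ℝ)| < w * M := by
    intro b n
    have : c * M - ((b + n * M : ℤ) : ℝ) = (c - b / M - n) * M := by
      push_cast; field_simp; ring
    rw [this, abs_mul, abs_of_pos hM', mul_lt_mul_iff_left₀ hM']
  -- Reduction modulo `M` matches the two sets: the open interval has length `2 * w * M ≤ M`, so its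
  -- integers are pairwise incongruent.
  have hcard : ((Finset.range M).filter fun b : ℕ => torusNorm (c - b / M) < w).card
      = (Finset.Ioo ⌊c * M - w * M⌋ ⌈c * M + w * M⌉).card := by
    apply le_antisymm
    · refine Finset.card_le_card_of_forall_subsingleton
        (fun (b : ℕ) (z : ℤ) => ∃ n : ℤ, z = b + n * M) ?_ ?_
      · intro b hb
        rw [Finset.mem_filter, torusNorm_lt_iff] at hb
        obtain ⟨-, n, hn⟩ := hb
        exact ⟨b + n * M, mem_Ioo_floor_ceil.2 ((key b n).1 hn), n, rfl⟩
      · rintro z - b ⟨hb, n, hn⟩ b' ⟨hb', n', hn'⟩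
        simp only [Finset.mem_filter, Finset.mem_range] at hb hb'
        have h1 : (b : ℤ) % M = b' % M := by
          have e1 : (b : ℤ) % M = z % M := by rw [hn, Int.add_mul_emod_self_right]
          have e2 : (b' : ℤ) % M = z % M := by rw [hn', Int.add_mul_emod_self_right]
          rw [e1, e2]
        rw [Int.emod_eq_of_lt (by omega) (by omega), Int.emod_eq_of_lt (by omega) (by omega)] at h1
        exact_mod_cast h1
    · refine Finset.card_le_card_of_forall_subsingleton
        (fun (z : ℤ) (b : ℕ) => ∃ n : ℤ, z = b + n * M) ?_ ?_
      · intro z hz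
        rw [mem_Ioo_floor_ceil] at hz
        have hb0 : 0 ≤ z % (M : ℤ) := Int.emod_nonneg _ (by omega)
        have hb1 : z % (M : ℤ) < M := Int.emod_lt_of_pos _ (by omega)
        have hz' : z = (((z % M).toNat : ℕ) : ℤ) + (z / M) * M := by
          rw [Int.toNat_of_nonneg hb0, Int.emod_add_ediv_mul]
        refine ⟨(z % M).toNat, ?_, z / M, hz'⟩
        rw [Finset.mem_filter, torusNorm_lt_iff, Finset.mem_range]
        refine ⟨by omega, z / M, (key _ _).2 ?_⟩
        rwa [← hz']
      · rintro b - z ⟨hz, n, hn⟩ z' ⟨hz', n', hn'⟩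
        have hz1 := abs_lt.1 (mem_Ioo_floor_ceil.1 hz)
        have hz2 := abs_lt.1 (mem_Ioo_floor_ceil.1 hz')
        have hlt : |((z - z' : ℤ) : ℝ)| < M := by
          rw [abs_lt]; push_cast; constructor <;> nlinarith
        have hlt' : |z - z'| < M := by exact_mod_cast hlt
        have : z - z' = (n - n') * M := by rw [hn, hn']; ring
        rw [this, abs_mul, abs_of_nonneg (by omega : (0 : ℤ) ≤ M)] at hlt'
        have h0 : |n - n'| < 1 := by
          by_contra h
          push Not at h
          nlinarith
        have : n - n' = 0 := Int.abs_lt_one_iff.1 h0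
        rw [hn, hn', show n = n' by omega]
  rw [hcard]
  have := card_Ioo_floor_ceil (c * M) (w * M) (by positivity)
  rw [abs_le]
  constructor <;> linarith [this.1, this.2]

/-! ### Round-robin choices -/

section Balanced

variable {τ : Type*} [DecidableEq τ]

/-- The index of `a` among the elements with the same value of `φ`, reduced modulo `K`. -/
def roundRobin (φ : ℕ → τ) (K a : ℕ) : ℕ := Nat.count (fun b => φ b = φ a) a % K

theorem roundRobin_lt (φ : ℕ → τ) {K : ℕ} (hK : 0 < K) (a : ℕ) : roundRobin φ K a < K :=
  Nat.mod_lt _ hK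

/-- Inside the class of `t` the choice is the rank modulo `K`, so only ranks need counting. -/
theorem count_roundRobin (φ : ℕ → τ) (K : ℕ) (t : τ) (i : ℕ) (hi : i < K) (R : ℕ) :
    Nat.count (fun a => φ a = t ∧ roundRobin φ K a = i) R
      = Nat.count (· ≡ i [MOD K]) (Nat.count (fun a => φ a = t) R) := by
  induction R with
  | zero => simp
  | succ R ih =>
    rw [Nat.count_succ, ih, Nat.count_succ (fun a => φ a = t)]
    by_cases h : φ R = t
    · rw [if_pos h, Nat.count_succ]
      congr 1
      have : roundRobin φ K R = Nat.count (fun a => φ a = t) R % K := by rw [roundRobin, h]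
      rw [this]
      simp only [h, true_and, Nat.ModEq, Nat.mod_eq_of_lt hi]
    · simp [h]

theorem abs_card_roundRobin_sub_le (φ : ℕ → τ) (K : ℕ) (t : τ) (i : ℕ) (hi : i < K) (R : ℕ) :
    |(((Finset.range R).filter fun a => φ a = t ∧ roundRobin φ K a = i).card : ℝ)
      - ((Finset.range R).filter fun a => φ a = t).card / K| ≤ 1 := by
  rw [← Nat.count_eq_card_filter_range, ← Nat.count_eq_card_filter_range, count_roundRobin φ K t i hi]
  set v := Nat.count (fun a => φ a = t) R
  have hK : 0 < K := by omega
  have hK' : (0 : ℝ) < K := by exact_mod_cast hK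
  rw [Nat.count_modEq_card _ hK]
  have h1 : ((v / K : ℕ) : ℝ) ≤ v / K := Nat.cast_div_le
  have h2 : (v : ℝ) / K < (v / K : ℕ) + 1 := by
    rw [div_lt_iff₀ hK']
    have := Nat.lt_div_mul_add (a := v) hK
    have : v < (v / K + 1) * K := by linarith
    exact_mod_cast this
  rw [abs_le]
  split_ifs <;> push_cast <;> constructor <;> linarith

/-- Sums over a round-robin choice are close to the averages over all choices. -/
theorem abs_sum_roundRobin_sub_le (φ : ℕ → τ) (K : ℕ) (hK : 0 < K) (R : ℕ) (T : Finset τ)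
    (hT : ∀ a < R, φ a ∈ T) (C : τ → ℕ → ℝ) (B : ℝ) (hC : ∀ t ∈ T, ∀ i < K, |C t i| ≤ B) :
    |∑ a ∈ Finset.range R, C (φ a) (roundRobin φ K a)
      - (∑ a ∈ Finset.range R, ∑ i ∈ Finset.range K, C (φ a) i) / K| ≤ T.card * K * B := by
  -- Grouped by type and choice, `C t i` has as weight a class count in the sum and `1 / K` of the
  -- type count in the average. These differ by at most 1, for each of `T.card * K` terms.
  have h1 : ∑ a ∈ Finset.range R, C (φ a) (roundRobin φ K a) = ∑ t ∈ T, ∑ i ∈ Finset.range K,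
      ((Finset.range R).filter fun a => φ a = t ∧ roundRobin φ K a = i).card * C t i := by
    rw [← Finset.sum_product']
    rw [← Finset.sum_fiberwise_of_maps_to (s := Finset.range R) (t := T ×ˢ Finset.range K)
      (g := fun a => (φ a, roundRobin φ K a))]
    · refine Finset.sum_congr rfl fun q _ => ?_
      rw [← nsmul_eq_mul, ← Finset.sum_const]
      refine Finset.sum_congr ?_ ?_
      · ext a; simp [Prod.ext_iff]
      · intro a ha
        simp only [Finset.mem_filter] at ha
        rw [ha.2.1, ha.2.2]
    · intro a ha
      simp only [Finset.mem_product, Finset.mem_range] at ha ⊢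
      exact ⟨hT a ha, roundRobin_lt φ hK a⟩
  have h2 : (∑ a ∈ Finset.range R, ∑ i ∈ Finset.range K, C (φ a) i) / K
      = ∑ t ∈ T, ∑ i ∈ Finset.range K,
        ((Finset.range R).filter fun a => φ a = t).card / K * C t i := by
    rw [← Finset.sum_fiberwise_of_maps_to (s := Finset.range R) (t := T) (g := φ)
      (fun a ha => hT a (Finset.mem_range.1 ha)), Finset.sum_div]
    refine Finset.sum_congr rfl fun t _ => ?_
    rw [← Finset.mul_sum, div_mul_eq_mul_div]
    congr 1
    rw [← nsmul_eq_mul, ← Finset.sum_const]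
    refine Finset.sum_congr rfl fun a ha => ?_
    rw [(Finset.mem_filter.1 ha).2]
  rw [h1, h2, ← Finset.sum_sub_distrib]
  refine (Finset.abs_sum_le_sum_abs _ _).trans ?_
  calc _ ≤ ∑ t ∈ T, (K * B : ℝ) := by
        refine Finset.sum_le_sum fun t ht => ?_
        rw [← Finset.sum_sub_distrib]
        refine (Finset.abs_sum_le_sum_abs _ _).trans ?_
        calc _ ≤ ∑ i ∈ Finset.range K, B := by
              refine Finset.sum_le_sum fun i hi => ?_
              rw [← sub_mul, abs_mul]
              have := abs_card_roundRobin_sub_le φ K t i (Finset.mem_range.1 hi) R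
              calc _ ≤ 1 * B := mul_le_mul this (hC t ht i (Finset.mem_range.1 hi)) (abs_nonneg _) zero_le_one
                _ = B := one_mul B
          _ = K * B := by simp
    _ = T.card * K * B := by simp [mul_assoc]

end Balanced

/-! ### Counting close pairs -/

open Classical in
/-- The number of ordered pairs of distinct indices below `N` whose terms are closer than `w`. -/
noncomputable def closePairs (x : ℕ → ℝ) (N : ℕ) (w : ℝ) : ℝ :=
  ∑ i ∈ Finset.range N, ∑ j ∈ Finset.range N,
    if i ≠ j ∧ torusNorm (x i - x j) < w then 1 else 0

theorem closePairs_congr {x y : ℕ → ℝ} {N : ℕ} (h : ∀ i < N, x i = y i) (w : ℝ) :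
    closePairs x N w = closePairs y N w := by
  refine Finset.sum_congr rfl fun i hi => Finset.sum_congr rfl fun j hj => ?_
  rw [h i (Finset.mem_range.1 hi), h j (Finset.mem_range.1 hj)]

theorem closePairs_nonneg (x : ℕ → ℝ) (N : ℕ) (w : ℝ) : 0 ≤ closePairs x N w :=
  Finset.sum_nonneg fun i _ => Finset.sum_nonneg fun j _ => by split_ifs <;> norm_num

theorem closePairs_mono (x : ℕ → ℝ) {N N' : ℕ} (h : N ≤ N') (w : ℝ) :
    closePairs x N w ≤ closePairs x N' w := by
  have hnn : ∀ i j, (0 : ℝ) ≤ if i ≠ j ∧ torusNorm (x i - x j) < w then 1 else 0 :=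
    fun i j => by split_ifs <;> norm_num
  calc _ ≤ ∑ i ∈ Finset.range N, ∑ j ∈ Finset.range N',
        (if i ≠ j ∧ torusNorm (x i - x j) < w then (1 : ℝ) else 0) :=
        Finset.sum_le_sum fun i _ => Finset.sum_le_sum_of_subset_of_nonneg
          (Finset.range_mono h) fun j _ _ => hnn i j
    _ ≤ _ := Finset.sum_le_sum_of_subset_of_nonneg (Finset.range_mono h)
          fun i _ _ => Finset.sum_nonneg fun j _ => hnn i j

theorem closePairs_le_sq (x : ℕ → ℝ) (N : ℕ) (w : ℝ) : closePairs x N w ≤ (N : ℝ) ^ 2 := by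
  calc closePairs x N w ≤ ∑ i ∈ Finset.range N, ∑ j ∈ Finset.range N, (1 : ℝ) :=
        Finset.sum_le_sum fun i _ => Finset.sum_le_sum fun j _ => by split_ifs <;> norm_num
    _ = (N : ℝ) ^ 2 := by simp [sq]

open Classical in
theorem closePairs_eq_card (x : ℕ → ℝ) (N : ℕ) (w : ℝ) :
    closePairs x N w = (((Finset.range N ×ˢ Finset.range N).filter fun q : ℕ × ℕ =>
      q.1 ≠ q.2 ∧ torusNorm (x q.1 - x q.2) < w).card : ℝ) := by
  rw [closePairs, ← Finset.sum_product', Finset.sum_boole]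

open Classical in
theorem closePairs_add (x : ℕ → ℝ) (N R : ℕ) (w : ℝ) :
    closePairs x (N + R) w = closePairs x N w
      + 2 * ∑ a ∈ Finset.range R,
          (((Finset.range N).filter fun i => torusNorm (x i - x (N + a)) < w).card : ℝ)
      + closePairs (fun a => x (N + a)) R w := by
  have hcross : ∑ i ∈ Finset.range N, ∑ a ∈ Finset.range R,
      (if i ≠ N + a ∧ torusNorm (x i - x (N + a)) < w then (1 : ℝ) else 0)
      = ∑ a ∈ Finset.range R,
          (((Finset.range N).filter fun i => torusNorm (x i - x (N + a)) < w).card : ℝ) := by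
    rw [Finset.sum_comm]
    refine Finset.sum_congr rfl fun a _ => ?_
    rw [← Finset.sum_boole]
    refine Finset.sum_congr rfl fun i hi => ?_
    have : i ≠ N + a := by have := Finset.mem_range.1 hi; omega
    simp [this]
  have hcross' : ∑ a ∈ Finset.range R, ∑ i ∈ Finset.range N,
      (if N + a ≠ i ∧ torusNorm (x (N + a) - x i) < w then (1 : ℝ) else 0)
      = ∑ a ∈ Finset.range R,
          (((Finset.range N).filter fun i => torusNorm (x i - x (N + a)) < w).card : ℝ) := by
    rw [← hcross, Finset.sum_comm]
    refine Finset.sum_congr rfl fun i hi => Finset.sum_congr rfl fun a _ => ?_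
    have h : i ≠ N + a := by have := Finset.mem_range.1 hi; omega
    simp only [h, h.symm, ne_eq, not_false_eq_true, true_and, torusNorm_sub_comm (x i)]
  have e : closePairs (fun a => x (N + a)) R w
      = ∑ a ∈ Finset.range R, ∑ b ∈ Finset.range R,
        (if N + a ≠ N + b ∧ torusNorm (x (N + a) - x (N + b)) < w then (1 : ℝ) else 0) := by
    simp [closePairs]
  rw [e, closePairs, Finset.sum_range_add]
  simp_rw [Finset.sum_range_add _ N R, Finset.sum_add_distrib]
  rw [hcross, hcross', closePairs]
  ring

/-! ### Occupancy patterns and cells -/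

theorem torusNorm_grid_lt_iff {G : ℕ} (hG : 0 < G) (u v : ℤ) (w : ℝ) :
    torusNorm ((u : ℝ) / G - (v : ℝ) / G) < w ↔ ∃ n : ℤ, |((u - v - n * G : ℤ) : ℝ)| < w * G := by
  have hG' : (0 : ℝ) < G := by exact_mod_cast hG
  rw [torusNorm_lt_iff]
  refine exists_congr fun n => ?_
  have : ((u - v - n * G : ℤ) : ℝ) = ((u : ℝ) / G - (v : ℝ) / G - n) * G := by
    push_cast; field_simp
  rw [this, abs_mul, abs_of_pos hG', mul_lt_mul_iff_left₀ hG']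

open Classical in
/-- The grid positions `z` relative to `c`, with `z ∈ [-E, 2E)`, that are occupied modulo `G`. -/
noncomputable def occupied (p : ℕ → ℤ) (N G E : ℕ) (c : ℤ) : Finset ℤ :=
  (Finset.Ico (-(E : ℤ)) (2 * E)).filter fun z => ∃ i < N, (G : ℤ) ∣ p i - c - z

open Classical in
-- Since `w * G ≤ E`, a point close to a position of the cell lies in the cell or next to it, within
-- the window. This makes the count a function of the local pattern. The condition `2 * w ≤ 1`
-- prevents a point from being counted at two lifts.
theorem card_near_eq_card_occupied (p : ℕ → ℤ) (N G E : ℕ) (hG : 0 < G)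
    (hp : ∀ i < N, 0 ≤ p i ∧ p i < G) (hinj : ∀ i < N, ∀ j < N, p i = p j → i = j)
    (c σ : ℤ) (hσ0 : 0 ≤ σ) (hσE : σ < E) (w : ℝ) (hwE : w * G ≤ E) (hw2 : 2 * w ≤ 1) :
    ((Finset.range N).filter fun i =>
        torusNorm ((p i : ℝ) / G - ((c + σ : ℤ) : ℝ) / G) < w).card
      = ((occupied p N G E c).filter fun z : ℤ => |((z - σ : ℤ) : ℝ)| < w * G).card := by
  have hG' : (0 : ℝ) < G := by exact_mod_cast hG
  apply le_antisymm
  · refine Finset.card_le_card_of_forall_subsingleton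
      (fun (i : ℕ) (z : ℤ) => (G : ℤ) ∣ p i - c - z) ?_ ?_
    · intro i hi
      rw [Finset.mem_filter, Finset.mem_range, torusNorm_grid_lt_iff hG] at hi
      obtain ⟨hiN, n, hn⟩ := hi
      refine ⟨p i - c - n * G, ?_, n, by ring⟩
      have e : p i - (c + σ) - n * G = p i - c - n * G - σ := by ring
      rw [e] at hn
      have hn1 := abs_lt.1 (hn.trans_le hwE)
      have h1 : -(E : ℤ) < p i - c - n * G - σ := by exact_mod_cast hn1.1
      have h2 : p i - c - n * G - σ < (E : ℤ) := by exact_mod_cast hn1.2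
      rw [Finset.mem_filter, occupied, Finset.mem_filter, Finset.mem_Ico]
      exact ⟨⟨⟨by linarith, by linarith⟩, i, hiN, n, by ring⟩, hn⟩
    · rintro z - i ⟨hi, hd⟩ j ⟨hj, hd'⟩
      simp only [Finset.mem_filter, Finset.mem_range] at hi hj
      refine hinj i hi.1 j hj.1 ?_
      have h1 := hp i hi.1
      have h2 := hp j hj.1
      have h3 : (G : ℤ) ∣ p i - p j := by
        have := dvd_sub hd hd'
        ring_nf at this ⊢
        exact this
      have := Int.eq_zero_of_abs_lt_dvd h3 (abs_lt.2 ⟨by linarith, by linarith⟩)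
      linarith
  · refine Finset.card_le_card_of_forall_subsingleton
      (fun (z : ℤ) (i : ℕ) => (G : ℤ) ∣ p i - c - z) ?_ ?_
    · intro z hz
      rw [Finset.mem_filter, occupied, Finset.mem_filter] at hz
      obtain ⟨⟨-, i, hi, hd⟩, hz⟩ := hz
      refine ⟨i, ?_, hd⟩
      rw [Finset.mem_filter, Finset.mem_range, torusNorm_grid_lt_iff hG]
      obtain ⟨n, hn⟩ := hd
      refine ⟨hi, n, ?_⟩
      rwa [show p i - (c + σ) - n * G = z - σ by linarith]
    · rintro i - z ⟨hz, hd⟩ z' ⟨hz', hd'⟩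
      have h1 := abs_lt.1 (Finset.mem_filter.1 hz).2
      have h2 := abs_lt.1 (Finset.mem_filter.1 hz').2
      have hlt : |((z - z' : ℤ) : ℝ)| < G := by
        push_cast at h1 h2 ⊢
        rw [abs_lt]; constructor <;> nlinarith
      have hlt' : |z - z'| < G := by exact_mod_cast hlt
      have h3 : (G : ℤ) ∣ z - z' := by
        have := dvd_sub hd' hd
        ring_nf at this ⊢
        exact this
      have := Int.eq_zero_of_abs_lt_dvd h3 hlt'
      linarith

open Classical in
/-- Points in distinct cells `[a * E, (a + 1) * E)` are close only if they are near the ends of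
their cells. -/
theorem closePairs_cells_le (R E : ℕ) (hE : 0 < E) (hR : 0 < R) (y : ℕ → ℝ) (σ : ℕ → ℤ)
    (hσ0 : ∀ a < R, 0 ≤ σ a) (hσE : ∀ a < R, σ a < E)
    (hy : ∀ a < R, y a = ((a * E + σ a : ℤ) : ℝ) / (R * E : ℕ)) (w : ℝ)
    (hwE : w * (R * E : ℕ) ≤ E) :
    closePairs y R w ≤
      ((Finset.range R).filter fun a => (σ a : ℝ) < w * (R * E : ℕ)).card
      + ((Finset.range R).filter fun a => (E : ℝ) - σ a < w * (R * E : ℕ)).card := by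
  set W : ℝ := w * (R * E : ℕ) with hW
  have hE' : (0 : ℝ) < E := by exact_mod_cast hE
  rw [closePairs_eq_card]
  -- The cyclic difference `d` of the cell numbers is nonzero, and closeness forces it to be `1` or
  -- `-1`. Then the first point is near the left or right end of its cell respectively, and its cell
  -- determines the other one.
  have hsub : ((Finset.range R ×ˢ Finset.range R).filter fun q : ℕ × ℕ =>
      q.1 ≠ q.2 ∧ torusNorm (y q.1 - y q.2) < w) ⊆
      (((Finset.range R).filter fun a => (σ a : ℝ) < W).image
        fun a => (a, (((a : ℤ) - 1) % R).toNat)) ∪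
      (((Finset.range R).filter fun a => (E : ℝ) - σ a < W).image
        fun a => (a, (((a : ℤ) + 1) % R).toNat)) := by
    rintro ⟨a, b⟩ hab
    simp only [Finset.mem_filter, Finset.mem_product, Finset.mem_range] at hab
    obtain ⟨⟨ha, hb⟩, hne, hlt⟩ := hab
    rw [hy a ha, hy b hb, torusNorm_grid_lt_iff (by positivity)] at hlt
    obtain ⟨n, hn⟩ := hlt
    obtain ⟨d, hd⟩ : ∃ d : ℤ, d = a - b - n * R := ⟨_, rfl⟩
    have e : (a * E + σ a - (b * E + σ b) - n * (R * E : ℕ) : ℤ) = d * E + (σ a - σ b) := by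
      rw [hd]; push_cast; ring
    rw [e, ← hW] at hn
    have hd0 : d ≠ 0 := by
      rintro rfl
      apply hne
      have h1 : (R : ℤ) ∣ (a : ℤ) - b := ⟨n, by linarith⟩
      have := Int.eq_zero_of_abs_lt_dvd h1 (abs_lt.2 ⟨by omega, by omega⟩)
      omega
    have hn1 := abs_lt.1 hn
    have hn2 := abs_lt.1 (hn.trans_le hwE)
    have i1 : -(E : ℤ) < d * E + (σ a - σ b) := by exact_mod_cast hn2.1
    have i2 : d * E + (σ a - σ b) < (E : ℤ) := by exact_mod_cast hn2.2
    have s1 := hσ0 a ha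
    have s2 := hσ0 b hb
    have s3 := hσE a ha
    have s4 := hσE b hb
    have hd1 : -2 < d := by by_contra h; push Not at h; nlinarith
    have hd2 : d < 2 := by by_contra h; push Not at h; nlinarith
    rw [Finset.mem_union, Finset.mem_image, Finset.mem_image]
    have s2' : (0 : ℝ) ≤ σ b := by exact_mod_cast s2
    have s4' : (σ b : ℝ) < E := by exact_mod_cast s4
    push_cast at hn1
    have hbm : ((b : ℤ) % R).toNat = b := by
      rw [Int.emod_eq_of_lt (by omega) (by omega)]; simp
    rcases (by omega : d = 1 ∨ d = -1) with h | h
    · left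
      refine ⟨a, ?_, ?_⟩
      · rw [Finset.mem_filter, Finset.mem_range]
        rw [h] at hn1
        push_cast at hn1
        exact ⟨ha, by linarith [hn1.2]⟩
      · rw [show (a : ℤ) - 1 = b + n * R by linarith, Int.add_mul_emod_self_right, hbm]
    · right
      refine ⟨a, ?_, ?_⟩
      · rw [Finset.mem_filter, Finset.mem_range]
        rw [h] at hn1
        push_cast at hn1
        exact ⟨ha, by linarith [hn1.1]⟩
      · rw [show (a : ℤ) + 1 = b + n * R by linarith, Int.add_mul_emod_self_right, hbm]
  have := (Finset.card_le_card hsub).trans ((Finset.card_union_le _ _).trans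
    (add_le_add Finset.card_image_le Finset.card_image_le))
  exact_mod_cast this

theorem sum_range_mul_eq (f : ℕ → ℝ) (R K : ℕ) :
    ∑ a ∈ Finset.range R, ∑ i ∈ Finset.range K, f (a * K + i) = ∑ b ∈ Finset.range (R * K), f b := by
  induction R with
  | zero => simp
  | succ R ih => rw [Finset.sum_range_succ, ih, Nat.succ_mul, Finset.sum_range_add]

/-! ### A single layer -/

/-- The contribution to the error of a layer that depends only on the local parameters. -/
noncomputable def layerError (m K : ℕ) : ℝ := 2 ^ (3 * (2 * K * m)) * K * (2 * (3 * (2 * K * m)) + 2)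

/-- The sites available to layer `l` in a cell. -/
def site (m l i : ℕ) : ℕ := 2 * m * i + 2 * l + 1

theorem site_lt {m K l i : ℕ} (hl : l < m) (hi : i < K) : site m l i < 2 * K * m := by
  unfold site
  nlinarith

open Classical in
theorem card_site_lt_le (m l K : ℕ) (hm : 0 < m) (r : ℝ) (hr : 0 ≤ r) :
    (((Finset.range K).filter fun i => (site m l i : ℝ) < r * (2 * m)).card : ℝ) ≤ r + 1 := by
  have hm' : (0 : ℝ) < m := by exact_mod_cast hm
  have hsub : (Finset.range K).filter (fun i => (site m l i : ℝ) < r * (2 * m))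
      ⊆ Finset.range ⌈r⌉₊ := by
    intro i hi
    rw [Finset.mem_range, Nat.lt_ceil]
    have := (Finset.mem_filter.1 hi).2
    unfold site at this
    push_cast at this
    have hl : (0 : ℝ) ≤ l := by positivity
    by_contra h
    push Not at h
    nlinarith
  have h1 := Finset.card_le_card hsub
  rw [Finset.card_range] at h1
  have h2 := Nat.ceil_lt_add_one hr
  have h3 : (((Finset.range K).filter fun i => (site m l i : ℝ) < r * (2 * m)).card : ℝ) ≤ ⌈r⌉₊ := by
    exact_mod_cast h1
  linarith

open Classical in
theorem card_sub_site_lt_le (m l K : ℕ) (hl : l < m) (r : ℝ) (hr : 0 ≤ r) :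
    (((Finset.range K).filter fun i => 2 * K * m - (site m l i : ℝ) < r * (2 * m)).card : ℝ)
      ≤ r + 1 := by
  have hm' : (0 : ℝ) < m := by exact_mod_cast (by omega : 0 < m)
  have hl' : (l : ℝ) + 1 ≤ m := by exact_mod_cast hl
  have hsub : (Finset.range K).filter (fun i => 2 * K * m - (site m l i : ℝ) < r * (2 * m))
      ⊆ (Finset.range ⌈r⌉₊).image fun i => K - 1 - i := by
    intro i hi
    rw [Finset.mem_filter, Finset.mem_range] at hi
    rw [Finset.mem_image]
    refine ⟨K - 1 - i, ?_, by omega⟩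
    rw [Finset.mem_range, Nat.lt_ceil]
    have := hi.2
    unfold site at this
    push_cast at this
    have hK : ((K - 1 - i : ℕ) : ℝ) = K - 1 - i := by
      rw [Nat.cast_sub (by omega), Nat.cast_sub (by omega)]; simp
    rw [hK]
    by_contra h
    push Not at h
    nlinarith
  have h1 := (Finset.card_le_card hsub).trans Finset.card_image_le
  rw [Finset.card_range] at h1
  have h2 := Nat.ceil_lt_add_one hr
  have h3 : (((Finset.range K).filter fun i =>
      2 * K * m - (site m l i : ℝ) < r * (2 * m)).card : ℝ) ≤ ⌈r⌉₊ := by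
    exact_mod_cast h1
  linarith

open Classical in
/-- On average over all sites of a layer, the number of close pairs of a given point and the
chosen sites is `2 * w * R` up to the discretization error. -/
theorem abs_sum_card_near_sites_sub_le (m K R l N : ℕ) (hm : 0 < m) (hK : 0 < K) (hR : 0 < R)
    (p : ℕ → ℤ) (w : ℝ) (hw : 0 ≤ w) (hw2 : 2 * w ≤ 1) :
    |∑ a ∈ Finset.range R, ∑ i ∈ Finset.range K,
      (((Finset.range N).filter fun i' => torusNorm ((p i' : ℝ) / (R * (2 * K * m) : ℕ)
        - ((a * (2 * K * m : ℕ) + site m l i : ℤ) : ℝ) / (R * (2 * K * m) : ℕ)) < w).card : ℝ)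
      - N * (2 * w * (R * K : ℕ))| ≤ N := by
  set G := R * (2 * K * m) with hG
  have hGpos : (0 : ℝ) < G := by
    have : 0 < G := by positivity
    exact_mod_cast this
  set f : ℕ → ℝ := fun b => (((Finset.range N).filter fun i' => torusNorm ((p i' : ℝ) / G
        - ((site m l b : ℤ) : ℝ) / G) < w).card : ℝ) with hf
  have h1 : ∀ a i : ℕ, (((Finset.range N).filter fun i' => torusNorm ((p i' : ℝ) / G
        - ((a * (2 * K * m : ℕ) + site m l i : ℤ) : ℝ) / G) < w).card : ℝ) = f (a * K + i) := by
    intro a i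
    have : ((a * (2 * K * m : ℕ) + site m l i : ℤ)) = (site m l (a * K + i) : ℤ) := by
      unfold site; push_cast; ring
    rw [this]
  simp_rw [h1]
  rw [sum_range_mul_eq]
  -- Over all cells, the sites of layer `l` are `R * K` equally spaced points, so each old point
  -- sees `2 * w * R * K` of them up to an error of 1.
  have h2 : ∑ b ∈ Finset.range (R * K), f b = ∑ i' ∈ Finset.range N,
      (((Finset.range (R * K)).filter fun b : ℕ =>
        torusNorm (((p i' : ℝ) - 2 * l - 1) / G - b / (R * K : ℕ)) < w).card : ℝ) := by
    simp_rw [hf, ← Finset.sum_boole]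
    rw [Finset.sum_comm]
    refine Finset.sum_congr rfl fun i _ => Finset.sum_congr rfl fun b _ => ?_
    have : (p i : ℝ) / G - ((site m l b : ℤ) : ℝ) / G
        = ((p i : ℝ) - 2 * l - 1) / G - b / (R * K : ℕ) := by
      have hR' : (0 : ℝ) < R := by exact_mod_cast hR
      have hK' : (0 : ℝ) < K := by exact_mod_cast hK
      have hm' : (0 : ℝ) < m := by exact_mod_cast hm
      unfold site
      rw [hG]; push_cast; field_simp; ring
    rw [this]
  rw [h2]
  calc _ = |∑ i' ∈ Finset.range N, ((((Finset.range (R * K)).filter fun b : ℕ =>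
        torusNorm (((p i' : ℝ) - 2 * l - 1) / G - b / (R * K : ℕ)) < w).card : ℝ)
          - 2 * w * (R * K : ℕ))| := by simp
    _ ≤ ∑ i' ∈ Finset.range N, (1 : ℝ) := (Finset.abs_sum_le_sum_abs _ _).trans
        (Finset.sum_le_sum fun i' _ => card_equispaced_near (R * K) (by positivity) _ w hw hw2)
    _ = N := by simp

open Classical in
/-- A layer of `R` points, one in each cell, can be added to a set of grid points so that the
number of close pairs grows as expected. -/
theorem exists_layer (m K R l N : ℕ) (hK : 0 < K) (hR : 0 < R) (hl : l < m)
    (p : ℕ → ℤ) (hp : ∀ i < N, 0 ≤ p i ∧ p i < (R * (2 * K * m) : ℕ))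
    (hinj : ∀ i < N, ∀ j < N, p i = p j → i = j) :
    ∃ s : ℕ → ℕ, (∀ a, s a < K) ∧ ∀ x : ℕ → ℝ,
      (∀ i < N, x i = (p i : ℝ) / (R * (2 * K * m) : ℕ)) →
      (∀ a < R, x (N + a) =
        ((a * (2 * K * m : ℕ) + site m l (s a) : ℤ) : ℝ) / (R * (2 * K * m) : ℕ)) →
      ∀ w : ℝ, 0 ≤ w → w * R ≤ 1 → 2 * w ≤ 1 →
        |closePairs x (N + R) w - closePairs x N w - 4 * w * N * R|
          ≤ 2 * N / K + 2 * w * R ^ 2 + 2 * R / K + layerError m K := by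
  have hm : 0 < m := by omega
  set E := 2 * K * m with hE
  set G := R * E with hG
  have hEpos : 0 < E := by positivity
  have hGpos : 0 < G := by positivity
  have hR' : (0 : ℝ) < R := by exact_mod_cast hR
  have hK' : (0 : ℝ) < K := by exact_mod_cast hK
  have hm' : (0 : ℝ) < m := by exact_mod_cast hm
  -- The type of a cell is its pattern of old points; the number of types does not depend on `R` or
  -- `N`.
  set φ : ℕ → Finset ℤ := fun a => occupied p N G E (a * E) with hφ
  set T : Finset (Finset ℤ) := (Finset.Ico (-(E : ℤ)) (2 * E)).powerset with hT
  have hTcard : (T.card : ℝ) = 2 ^ (3 * E) := by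
    rw [hT, Finset.card_powerset, Int.card_Ico,
      show (2 * (E : ℤ) - -(E : ℤ)).toNat = 3 * E by omega]
    push_cast; rfl
  have hφT : ∀ a < R, φ a ∈ T := fun a _ =>
    Finset.mem_powerset.2 (Finset.filter_subset _ _)
  refine ⟨roundRobin φ K, roundRobin_lt φ hK, fun x hx hxN w hw hwR hw2 => ?_⟩
  have hGR : (G : ℝ) = R * E := by rw [hG]; push_cast; rfl
  have hER : (E : ℝ) = 2 * K * m := by rw [hE]; push_cast; rfl
  have hwE : w * G ≤ E := by
    rw [hGR, ← mul_assoc]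
    exact mul_le_of_le_one_left (by positivity) hwR
  have hs := roundRobin_lt φ hK
  have hcross : |∑ a ∈ Finset.range R,
      (((Finset.range N).filter fun i => torusNorm (x i - x (N + a)) < w).card : ℝ)
        - 2 * w * N * R| ≤ N / K + 2 ^ (3 * E) * K * (3 * E) := by
    set C : Finset ℤ → ℕ → ℝ := fun t i =>
      ((t.filter fun z : ℤ => |((z - site m l i : ℤ) : ℝ)| < w * G).card : ℝ) with hC
    have hCφ : ∀ a i : ℕ, i < K → (((Finset.range N).filter fun i' => torusNorm ((p i' : ℝ) / G
        - ((a * (E : ℕ) + site m l i : ℤ) : ℝ) / G) < w).card : ℝ) = C (φ a) i := by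
      intro a i hi
      rw [card_near_eq_card_occupied p N G E hGpos hp hinj (a * E) (site m l i) (by positivity)
        (by exact_mod_cast site_lt hl hi) w hwE hw2]
    have h1 : ∑ a ∈ Finset.range R,
        (((Finset.range N).filter fun i => torusNorm (x i - x (N + a)) < w).card : ℝ)
        = ∑ a ∈ Finset.range R, C (φ a) (roundRobin φ K a) := by
      refine Finset.sum_congr rfl fun a ha => ?_
      rw [← hCφ a _ (hs a)]
      congr 2
      refine Finset.filter_congr fun i hi => ?_
      rw [hx i (Finset.mem_range.1 hi), hxN a (Finset.mem_range.1 ha)]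
    have h2 := abs_sum_roundRobin_sub_le φ K hK R T hφT C (3 * E) (by
      intro t ht i _
      rw [hC, Nat.abs_cast]
      have : (t.filter fun z : ℤ => |((z - site m l i : ℤ) : ℝ)| < w * G).card ≤ 3 * E := by
        refine (Finset.card_filter_le _ _).trans
          ((Finset.card_le_card (Finset.mem_powerset.1 ht)).trans ?_)
        rw [Int.card_Ico]; omega
      exact_mod_cast this)
    have h3 := abs_sum_card_near_sites_sub_le m K R l N hm hK hR p w hw hw2
    have h4 : ∑ a ∈ Finset.range R, ∑ i ∈ Finset.range K,
      (((Finset.range N).filter fun i' => torusNorm ((p i' : ℝ) / (R * (2 * K * m) : ℕ)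
        - ((a * (2 * K * m : ℕ) + site m l i : ℤ) : ℝ) / (R * (2 * K * m) : ℕ)) < w).card : ℝ)
        = ∑ a ∈ Finset.range R, ∑ i ∈ Finset.range K, C (φ a) i :=
      Finset.sum_congr rfl fun a _ => Finset.sum_congr rfl fun i hi =>
        hCφ a i (Finset.mem_range.1 hi)
    rw [h4] at h3
    rw [hTcard] at h2
    have h5 : |(∑ a ∈ Finset.range R, ∑ i ∈ Finset.range K, C (φ a) i) / K - 2 * w * N * R|
        ≤ N / K := by
      have : (∑ a ∈ Finset.range R, ∑ i ∈ Finset.range K, C (φ a) i) / K - 2 * w * N * R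
          = (∑ a ∈ Finset.range R, ∑ i ∈ Finset.range K, C (φ a) i
              - N * (2 * w * (R * K : ℕ))) / K := by
        push_cast; field_simp
      rw [this, abs_div, abs_of_pos hK']
      gcongr
    rw [h1]
    calc _ ≤ _ := abs_sub_le _ ((∑ a ∈ Finset.range R, ∑ i ∈ Finset.range K, C (φ a) i) / K) _
      _ ≤ _ := by linarith
  -- Round robin applied to an indicator: the share of cells whose point is near an end is close to
  -- the share of sites near an end.
  have hbdry : ∀ P : ℕ → Prop,
      (((Finset.range K).filter fun i => P i).card : ℝ) ≤ w * R * K + 1 →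
      (((Finset.range R).filter fun a => P (roundRobin φ K a)).card : ℝ)
        ≤ w * R ^ 2 + R / K + 2 ^ (3 * E) * K := by
    intro P hP
    have h1 := abs_sum_roundRobin_sub_le φ K hK R T hφT (fun _ i => if P i then 1 else 0) 1
      (by intro t _ i _; split_ifs <;> simp)
    simp only [Finset.sum_boole, Finset.sum_const, Finset.card_range, nsmul_eq_mul, hTcard] at h1
    have h2 := (abs_le.1 h1).2
    have h3 : (R : ℝ) * ((Finset.range K).filter fun i => P i).card / K ≤ w * R ^ 2 + R / K := by
      calc _ ≤ (R : ℝ) * (w * R * K + 1) / K := by gcongr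
        _ = w * R ^ 2 + R / K := by field_simp
    linarith
  have hnn : closePairs (fun a => x (N + a)) R w
      ≤ 2 * (w * R ^ 2 + R / K + 2 ^ (3 * E) * K) := by
    have hwG : w * G = w * R * K * (2 * m) := by rw [hGR, hER]; ring
    have h1 := closePairs_cells_le R E hEpos hR (fun a => x (N + a))
      (fun a => (site m l (roundRobin φ K a) : ℤ)) (fun a _ => by positivity)
      (fun a _ => by exact_mod_cast site_lt hl (hs a)) hxN w hwE
    have h2 := hbdry (fun i => (site m l i : ℝ) < w * R * K * (2 * m))
      (card_site_lt_le m l K hm _ (by positivity))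
    have h3 := hbdry (fun i => 2 * K * m - (site m l i : ℝ) < w * R * K * (2 * m))
      (card_sub_site_lt_le m l K hl _ (by positivity))
    rw [← hG, hwG, hER] at h1
    simp only [Int.cast_natCast] at h1
    linarith
  have hnn0 := closePairs_nonneg (fun a => x (N + a)) R w
  -- Old-new pairs occur in both orders, with counts bounded by `3 * E`; the two boundary counts,
  -- with indicators bounded by 1, enter doubled through the bound for new-new pairs.
  have hLE : layerError m K = 2 * (2 ^ (3 * E) * K * (3 * E)) + 2 * (2 ^ (3 * E) * K) := by
    unfold layerError; rw [← hER, ← hE]; ring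
  rw [closePairs_add, hLE]
  have hc := abs_le.1 hcross
  have hpos : 0 ≤ (R : ℝ) / K := by positivity
  have hpos2 : 0 ≤ w * (R : ℝ) ^ 2 := by positivity
  have hpos3 : 0 ≤ (2 : ℝ) ^ (3 * E) * K := by positivity
  rw [mul_div_assoc, mul_div_assoc, abs_le]
  constructor <;> linarith [hc.1, hc.2]

/-! ### Assembling the layers into a sequence -/

/-- The first `N` terms of `x` are distinct points of the grid of mesh `1 / Q` in `[0, 1)`. -/
def DistinctOnGrid (Q : ℕ) (x : ℕ → ℝ) (N : ℕ) : Prop :=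
  (∀ i < N, ∃ p : ℤ, (0 ≤ p ∧ p < Q) ∧ x i = (p : ℝ) / Q) ∧ ∀ i < N, ∀ j < N, x i = x j → i = j

theorem DistinctOnGrid.congr {Q N : ℕ} {x y : ℕ → ℝ} (hx : DistinctOnGrid Q x N)
    (h : ∀ i < N, y i = x i) : DistinctOnGrid Q y N := by
  refine ⟨fun i hi => ?_, fun i hi j hj hij => ?_⟩
  · rw [h i hi]; exact hx.1 i hi
  · rw [h i hi, h j hj] at hij
    exact hx.2 i hi j hj hij

theorem DistinctOnGrid.refine {Q N : ℕ} {x : ℕ → ℝ} (hx : DistinctOnGrid Q x N) {c : ℕ}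
    (hc : 0 < c) : DistinctOnGrid (c * Q) x N := by
  refine ⟨fun i hi => ?_, hx.2⟩
  obtain ⟨p, ⟨h0, h1⟩, h2⟩ := hx.1 i hi
  refine ⟨c * p, ⟨by positivity, ?_⟩, ?_⟩
  · push_cast
    have : (0 : ℤ) < c := by exact_mod_cast hc
    nlinarith
  · rw [h2]
    have : (c : ℝ) ≠ 0 := by exact_mod_cast hc.ne'
    push_cast
    rw [mul_div_mul_left _ _ this]

/-- The terms of index `N, …, N + R - 1` form a layer: there is one in each of the `R` cells, at a
site of layer `l`, and they contribute the expected number of close pairs. -/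
def IsLayer (m K R l N : ℕ) (x : ℕ → ℝ) : Prop :=
  (∀ a < R, ∃ i < K, x (N + a) =
    ((a * (2 * K * m : ℕ) + site m l i : ℤ) : ℝ) / (R * (2 * K * m) : ℕ)) ∧
  ∀ w : ℝ, 0 ≤ w → w * R ≤ 1 → 2 * w ≤ 1 →
    |closePairs x (N + R) w - closePairs x N w - 4 * w * N * R|
      ≤ 2 * N / K + 2 * w * R ^ 2 + 2 * R / K + layerError m K

theorem IsLayer.congr {m K R l N : ℕ} {x y : ℕ → ℝ} (hx : IsLayer m K R l N x)
    (h : ∀ i < N + R, y i = x i) : IsLayer m K R l N y := by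
  refine ⟨fun a ha => ?_, fun w hw hwR hw2 => ?_⟩
  · rw [h _ (by omega)]; exact hx.1 a ha
  · rw [closePairs_congr h, closePairs_congr (fun i hi => h i (by omega : i < N + R))]
    exact hx.2 w hw hwR hw2

/-- Cells start at multiples of `2 * m`, so the residue identifies the layer. This keeps the layers
disjoint. -/
theorem site_emod {m l : ℕ} (hl : l < m) (a K i : ℕ) :
    ((a * (2 * K * m : ℕ) + site m l i : ℤ)) % (2 * m : ℕ) = 2 * l + 1 := by
  have h : ((a * (2 * K * m : ℕ) + site m l i : ℤ)) = (2 * l + 1) + (2 * m : ℕ) * (a * K + i) := by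
    unfold site; push_cast; ring
  rw [h, Int.add_mul_emod_self_left]
  exact Int.emod_eq_of_lt (by positivity) (by push_cast; omega)

/-- The invariant `hres` says that the residues reserved for the layers still to come are free. -/
theorem exists_extension_by_layer (m K R l N : ℕ) (hK : 0 < K) (hR : 0 < R) (hl : l < m)
    (x : ℕ → ℝ) (p : ℕ → ℤ) (hp : ∀ i < N, 0 ≤ p i ∧ p i < (R * (2 * K * m) : ℕ))
    (hx : ∀ i < N, x i = (p i : ℝ) / (R * (2 * K * m) : ℕ))
    (hinj : ∀ i < N, ∀ j < N, p i = p j → i = j)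
    (hres : ∀ i < N, ∀ l', l ≤ l' → l' < m → p i % (2 * m : ℕ) ≠ 2 * l' + 1) :
    ∃ (y : ℕ → ℝ) (q : ℕ → ℤ), (∀ i < N, y i = x i) ∧ IsLayer m K R l N y ∧
      (∀ i < N + R, 0 ≤ q i ∧ q i < (R * (2 * K * m) : ℕ)) ∧
      (∀ i < N + R, y i = (q i : ℝ) / (R * (2 * K * m) : ℕ)) ∧
      (∀ i < N + R, ∀ j < N + R, q i = q j → i = j) ∧
      (∀ i < N + R, ∀ l', l + 1 ≤ l' → l' < m → q i % (2 * m : ℕ) ≠ 2 * l' + 1) := by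
  obtain ⟨s, hs, hlay⟩ := exists_layer m K R l N hK hR hl p hp hinj
  set q : ℕ → ℤ := fun i => if i < N then p i else
    ((i - N : ℕ) * (2 * K * m : ℕ) + site m l (s (i - N)) : ℤ) with hq
  set y : ℕ → ℝ := fun i => if i < N then x i else (q i : ℝ) / (R * (2 * K * m) : ℕ) with hy
  have hq1 : ∀ i < N, q i = p i := fun i hi => by simp [hq, hi]
  have hq2 : ∀ a, q (N + a) = (a * (2 * K * m : ℕ) + site m l (s a) : ℤ) := fun a => by
    simp [hq]
  have hyN : ∀ i < N, y i = x i := fun i hi => by simp [hy, hi]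
  have hyN' : ∀ a, y (N + a) =
      ((a * (2 * K * m : ℕ) + site m l (s a) : ℤ) : ℝ) / (R * (2 * K * m) : ℕ) := fun a => by
    rw [← hq2]; simp [hy]
  have hsplit : ∀ i < N + R, i < N ∨ ∃ a < R, i = N + a := fun i hi => by
    rcases lt_or_ge i N with h | h
    · exact Or.inl h
    · exact Or.inr ⟨i - N, by omega, by omega⟩
  have hsite : ∀ a, ((site m l (s a) : ℕ) : ℤ) < (2 * K * m : ℕ) := fun a => by
    exact_mod_cast site_lt hl (hs a)
  refine ⟨y, q, hyN, ⟨fun a _ => ⟨s a, hs a, hyN' a⟩, ?_⟩, ?_, ?_, ?_, ?_⟩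
  · exact hlay y (fun i hi => (hyN i hi).trans (hx i hi)) (fun a _ => hyN' a)
  · intro i hi
    rcases hsplit i hi with h | ⟨a, ha, rfl⟩
    · rw [hq1 i h]; exact hp i h
    · rw [hq2]
      refine ⟨by positivity, ?_⟩
      have h1 := hsite a
      have h2 : ((a : ℤ) + 1) ≤ R := by exact_mod_cast ha
      have h3 : (0 : ℤ) ≤ (2 * K * m : ℕ) := by positivity
      rw [Nat.cast_mul R]
      nlinarith
  · intro i hi
    rcases hsplit i hi with h | ⟨a, ha, rfl⟩
    · rw [hyN i h, hq1 i h]; exact hx i h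
    · rw [hyN', hq2]
  · have hne : ∀ i < N, ∀ a < R, q i ≠ q (N + a) := by
      intro i hi a ha h
      apply hres i hi l le_rfl hl
      rw [← hq1 i hi, h, hq2, site_emod hl]
    intro i hi j hj hij
    rcases hsplit i hi with h | ⟨a, ha, rfl⟩ <;> rcases hsplit j hj with h' | ⟨b, hb, rfl⟩
    · exact hinj i h j h' (by rw [← hq1 i h, ← hq1 j h', hij])
    · exact absurd hij (hne i h b hb)
    · exact absurd hij.symm (hne j h' a ha)
    · rw [hq2, hq2] at hij
      have h1 := hsite a
      have h2 := hsite b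
      have h3 : (0 : ℤ) ≤ (site m l (s a) : ℕ) := by positivity
      have h4 : (0 : ℤ) ≤ (site m l (s b) : ℕ) := by positivity
      have h5 : ((2 * K * m : ℕ) : ℤ) ∣ (a * (2 * K * m : ℕ) + site m l (s a))
          - a * (2 * K * m : ℕ) - site m l (s b) := by
        rw [hij]; exact ⟨b - a, by ring⟩
      have h6 := Int.eq_zero_of_abs_lt_dvd h5 (abs_lt.2 ⟨by linarith, by linarith⟩)
      have h7 : (a : ℤ) * (2 * K * m : ℕ) = b * (2 * K * m : ℕ) := by linarith
      have h8 : ((2 * K * m : ℕ) : ℤ) ≠ 0 := by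
        have : 0 < 2 * K * m := by have : 0 < m := by omega
                                   positivity
        exact_mod_cast this.ne'
      have := mul_right_cancel₀ h8 h7
      omega
  · intro i hi l' hl' hl'm
    rcases hsplit i hi with h | ⟨a, ha, rfl⟩
    · rw [hq1 i h]; exact hres i h l' (by omega) hl'm
    · rw [hq2, site_emod hl]; omega

/-- Halving the mesh moves all old points to even positions, while sites are odd; so every layer
starts with free sites. -/
theorem exists_extension_by_layers (m K R N : ℕ) (hm : 0 < m) (hK : 0 < K) (hR : 0 < R)
    (x : ℕ → ℝ) (hx : DistinctOnGrid (R * (K * m)) x N) :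
    ∃ y : ℕ → ℝ, (∀ i < N, y i = x i) ∧ DistinctOnGrid (R * (2 * K * m)) y (N + m * R) ∧
      ∀ l < m, IsLayer m K R l (N + l * R) y := by
  have hG : (0 : ℝ) < (R * (2 * K * m) : ℕ) := by
    have : 0 < R * (2 * K * m) := by positivity
    exact_mod_cast this
  have key : ∀ l ≤ m, ∃ (y : ℕ → ℝ) (q : ℕ → ℤ), (∀ i < N, y i = x i) ∧
      (∀ l' < l, IsLayer m K R l' (N + l' * R) y) ∧
      (∀ i < N + l * R, 0 ≤ q i ∧ q i < (R * (2 * K * m) : ℕ)) ∧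
      (∀ i < N + l * R, y i = (q i : ℝ) / (R * (2 * K * m) : ℕ)) ∧
      (∀ i < N + l * R, ∀ j < N + l * R, q i = q j → i = j) ∧
      (∀ i < N + l * R, ∀ l', l ≤ l' → l' < m → q i % (2 * m : ℕ) ≠ 2 * l' + 1) := by
    intro l
    induction l with
    | zero =>
      intro _
      have h1 : ∀ i, ∃ p : ℤ, i < N → (0 ≤ p ∧ p < (R * (K * m) : ℕ)) ∧
          x i = (p : ℝ) / (R * (K * m) : ℕ) := fun i => by
        by_cases hi : i < N
        · obtain ⟨p, hp⟩ := hx.1 i hi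
          exact ⟨p, fun _ => hp⟩
        · exact ⟨0, fun h => absurd h hi⟩
      choose p hp using h1
      have hxp : ∀ i < N, x i = ((2 * p i : ℤ) : ℝ) / (R * (2 * K * m) : ℕ) := fun i hi => by
        rw [(hp i hi).2]; push_cast
        rw [show (R : ℝ) * (2 * K * m) = 2 * (R * (K * m)) by ring,
          mul_div_mul_left _ _ two_ne_zero]
      simp only [zero_mul, add_zero]
      refine ⟨x, fun i => 2 * p i, fun _ _ => rfl, fun _ h => absurd h (by omega), fun i hi => ?_,
        hxp, fun i hi j hj hij => ?_, fun i hi l' _ _ h => ?_⟩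
      · have := (hp i hi).1
        push_cast at this ⊢
        constructor
        · linarith
        · linarith
      · apply hx.2 i hi j hj
        rw [hxp i hi, hxp j hj]
        simp only at hij
        rw [hij]
      · have h1 := Int.emod_add_mul_ediv (2 * p i) (2 * m : ℕ)
        simp only at h
        rw [h] at h1
        push_cast at h1
        have h2 : (2 : ℤ) * (l' + m * (2 * p i / (2 * m)) - p i) = -1 := by linarith
        omega
    | succ l ih =>
      intro hl
      obtain ⟨y, q, h1, h2, h3, h4, h5, h6⟩ := ih (by omega)
      obtain ⟨z, r, g1, g2, g3, g4, g5, g6⟩ := exists_extension_by_layer m K R l (N + l * R) hK hR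
        (by omega) y q h3 h4 h5 h6
      have e : N + (l + 1) * R = N + l * R + R := by ring
      rw [e]
      refine ⟨z, r, fun i hi => ?_, fun l' hl' => ?_, g3, g4, g5, g6⟩
      · rw [g1 i (by omega), h1 i hi]
      · rcases Nat.lt_succ_iff_lt_or_eq.1 hl' with h | rfl
        · refine (h2 l' h).congr fun i hi => g1 i ?_
          have : (l' + 1) * R ≤ l * R := Nat.mul_le_mul_right _ h
          have e' : (l' + 1) * R = l' * R + R := by ring
          omega
        · exact g2
  obtain ⟨y, q, h1, h2, h3, h4, h5, -⟩ := key m le_rfl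
  refine ⟨y, h1, ⟨fun i hi => ⟨q i, h3 i hi, h4 i hi⟩, fun i hi j hj hij => h5 i hi j hj ?_⟩, h2⟩
  rw [h4 i hi, h4 j hj, div_left_inj' hG.ne'] at hij
  exact_mod_cast hij

/-- Since `m * R = 2 ^ k`, a block doubles the number of terms. It leaves the grid exponent `k + 1 +
2 * e k`, and monotonicity of `e` permits refining this to the `k + 1 + 2 * e (k + 1)` needed by the
next block. -/
theorem exists_layered_sequence (e : ℕ → ℕ) (he : Monotone e) (hek : ∀ k, e k ≤ k) :
    ∃ x : ℕ → ℝ, ∀ k, DistinctOnGrid (2 ^ (k + 1 + 2 * e k)) x (2 ^ (k + 1)) ∧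
      ∀ l < 2 ^ e k,
        IsLayer (2 ^ e k) (2 ^ (2 * e k)) (2 ^ (k - e k)) l (2 ^ k + l * 2 ^ (k - e k)) x := by
  have hgrid : ∀ k, 2 ^ (k - e k) * (2 ^ (2 * e k) * 2 ^ e k) = 2 ^ (k + 2 * e k) := fun k => by
    rw [← pow_add, ← pow_add]; congr 1; have := hek k; omega
  have hgrid' : ∀ k, 2 ^ (k - e k) * (2 * 2 ^ (2 * e k) * 2 ^ e k) = 2 ^ (k + 1 + 2 * e k) :=
    fun k => by
      rw [← pow_succ', ← pow_add, ← pow_add]; congr 1; have := hek k; omega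
  have hlen : ∀ k, 2 ^ k + 2 ^ e k * 2 ^ (k - e k) = 2 ^ (k + 1) := fun k => by
    rw [← pow_add, Nat.add_sub_cancel' (hek k), pow_succ]; ring
  -- The hypothesis stands inside the existential, so that `choose` yields a total step function
  -- that can be iterated.
  have step : ∀ k x, ∃ y : ℕ → ℝ, DistinctOnGrid (2 ^ (k + 2 * e k)) x (2 ^ k) →
      (∀ i < 2 ^ k, y i = x i) ∧ DistinctOnGrid (2 ^ (k + 1 + 2 * e k)) y (2 ^ (k + 1)) ∧
      ∀ l < 2 ^ e k,
        IsLayer (2 ^ e k) (2 ^ (2 * e k)) (2 ^ (k - e k)) l (2 ^ k + l * 2 ^ (k - e k)) y := by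
    intro k x
    by_cases hx : DistinctOnGrid (2 ^ (k + 2 * e k)) x (2 ^ k)
    · obtain ⟨y, h1, h2, h3⟩ := exists_extension_by_layers (2 ^ e k) (2 ^ (2 * e k))
        (2 ^ (k - e k)) (2 ^ k) (by positivity) (by positivity) (by positivity) x
        (by rw [hgrid]; exact hx)
      rw [hgrid', hlen] at h2
      exact ⟨y, fun _ => ⟨h1, h2, h3⟩⟩
    · exact ⟨x, fun h => absurd h hx⟩
  choose next hnext using step
  let z : ℕ → ℕ → ℝ := fun k => Nat.rec (fun _ => 0) (fun k x => next k x) k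
  have hz : ∀ k, z (k + 1) = next k (z k) := fun k => rfl
  have hentry : ∀ k, DistinctOnGrid (2 ^ (k + 2 * e k)) (z k) (2 ^ k) := by
    intro k
    induction k with
    | zero =>
      refine ⟨fun i _ => ⟨0, ⟨le_rfl, by positivity⟩, by simp [z]⟩, fun i hi j hj _ => ?_⟩
      simp only [pow_zero] at hi hj
      omega
    | succ k ih =>
      have h := (hnext k (z k) ih).2.1
      rw [← hz] at h
      have h' : e k ≤ e (k + 1) := he (Nat.le_succ k)
      have := h.refine (c := 2 ^ (2 * (e (k + 1) - e k))) (by positivity)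
      rwa [← pow_add, show 2 * (e (k + 1) - e k) + (k + 1 + 2 * e k) = k + 1 + 2 * e (k + 1) by
        omega] at this
  have hagree : ∀ k d, ∀ i < 2 ^ k, z (k + d) i = z k i := by
    intro k d
    induction d with
    | zero => intro i _; rfl
    | succ d ih =>
      intro i hi
      rw [← add_assoc, hz, (hnext _ _ (hentry _)).1 i
        (hi.trans_le (Nat.pow_le_pow_right (by norm_num) (by omega))), ih i hi]
  -- Stage `k` fixes the terms below `2 ^ k`, and `i < 2 ^ i`, so the diagonal agrees with every
  -- stage where the term is fixed.
  have hlim : ∀ k, ∀ i < 2 ^ k, z i i = z k i := by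
    intro k i hi
    rcases le_total i k with h | h
    · obtain ⟨d, rfl⟩ := Nat.exists_eq_add_of_le h
      exact (hagree i d i Nat.lt_two_pow_self).symm
    · obtain ⟨d, hd⟩ := Nat.exists_eq_add_of_le h
      rw [hd] at hi ⊢
      exact hagree k d _ hi
  refine ⟨fun i => z i i, fun k => ?_⟩
  obtain ⟨-, h2, h3⟩ := hnext k (z k) (hentry k)
  rw [← hz] at h2 h3
  refine ⟨h2.congr (hlim (k + 1)), fun l hl => (h3 l hl).congr fun i hi => hlim (k + 1) i ?_⟩
  have h4 : (l + 1) * 2 ^ (k - e k) ≤ 2 ^ e k * 2 ^ (k - e k) := Nat.mul_le_mul_right _ hl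
  have h5 : (l + 1) * 2 ^ (k - e k) = l * 2 ^ (k - e k) + 2 ^ (k - e k) := by ring
  have := hlen k
  omega

/-! ### Accumulation of errors and the limit -/

/-- The main term telescopes up to `2 * w * R ^ 2` per layer. With `K = m ^ 2` sites, a layer costs
`O(m * R / m ^ 2)` when `w * m * R` is bounded, so `m` layers cost only `O(m * R / m)`. -/
theorem abs_closePairs_sub_le_of_layers (m R : ℕ) (hm : 0 < m) (x : ℕ → ℝ)
    (hx : ∀ l < m, IsLayer m (m ^ 2) R l (m * R + l * R) x)
    (herr : layerError m (m ^ 2) * m ^ 2 ≤ m * R) (w : ℝ) (hw : 0 ≤ w) (hwR : w * R ≤ 1)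
    (hw2 : 2 * w ≤ 1) (l : ℕ) (hl : l ≤ m) :
    |closePairs x (m * R + l * R) w - 2 * w * (m * R + l * R) ^ 2|
      ≤ |closePairs x (m * R) w - 2 * w * (m * R) ^ 2| + m * R * (7 + 4 * w * (m * R)) / m := by
  have hm' : (1 : ℝ) ≤ m := by exact_mod_cast hm
  have hR : (0 : ℝ) ≤ R := by positivity
  have key : ∀ l ≤ m, |closePairs x (m * R + l * R) w - 2 * w * (m * R + l * R) ^ 2|
      ≤ |closePairs x (m * R) w - 2 * w * (m * R) ^ 2|
        + l * (m * R * (7 + 4 * w * (m * R)) / m ^ 2) := by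
    intro l
    induction l with
    | zero => intro _; simp
    | succ l ih =>
      intro hl
      have h1 := ih (by omega)
      have h2 := (hx l hl).2 w hw hwR hw2
      have hl' : (l : ℝ) + 1 ≤ m := by exact_mod_cast hl
      have e : m * R + (l + 1) * R = m * R + l * R + R := by ring
      rw [e]
      set D := closePairs x (m * R + l * R + R) w
      set C := closePairs x (m * R + l * R) w
      push_cast at h2 ⊢
      have b1 : 2 * ((m : ℝ) * R + l * R) / m ^ 2 ≤ 4 * (m * R) / m ^ 2 := by
        refine div_le_div_of_nonneg_right ?_ (by positivity)
        nlinarith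
      have b2 : 2 * (R : ℝ) / m ^ 2 ≤ 2 * (m * R) / m ^ 2 := by
        gcongr; nlinarith
      have b3 : layerError m (m ^ 2) ≤ m * R / m ^ 2 := by
        rw [le_div_iff₀ (by positivity)]; exact herr
      -- The constant is `7 = 4 + 2 + 1`, from `b1`, `b2`, `b3`. Half of `4 * w * R ^ 2` is the pair
      -- bound within the layer, half the telescoping defect.
      have b4 : m * R * (7 + 4 * w * (m * R)) / m ^ 2
          = 4 * (m * R) / m ^ 2 + 2 * (m * R) / m ^ 2 + m * R / m ^ 2 + 4 * w * R ^ 2 := by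
        field_simp; ring
      have h3 : |D - 2 * w * (m * R + (l + 1) * R) ^ 2| ≤
          |C - 2 * w * (m * R + l * R) ^ 2| + |D - C - 4 * w * (m * R + l * R) * R|
            + 2 * w * R ^ 2 := by
        have : D - 2 * w * (m * R + (l + 1) * R) ^ 2 = (C - 2 * w * (m * R + l * R) ^ 2)
            + (D - C - 4 * w * (m * R + l * R) * R) + (-(2 * w * R ^ 2)) := by ring
        rw [this]
        refine (abs_add_three _ _ _).trans ?_
        rw [abs_neg, abs_of_nonneg (by positivity : 0 ≤ 2 * w * (R : ℝ) ^ 2)]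
      set X : ℝ := m * R * (7 + 4 * w * (m * R)) / m ^ 2
      have h4 : ((l : ℝ) + 1) * X = l * X + X := by ring
      linarith
  refine (key l hl).trans ?_
  have hl' : (l : ℝ) ≤ m := by exact_mod_cast hl
  have : (l : ℝ) * (m * R * (7 + 4 * w * (m * R)) / m ^ 2)
      ≤ m * (m * R * (7 + 4 * w * (m * R)) / m ^ 2) := by gcongr
  have e : (m : ℝ) * (m * R * (7 + 4 * w * (m * R)) / m ^ 2)
      = m * R * (7 + 4 * w * (m * R)) / m := by field_simp
  linarith

section

variable {e : ℕ → ℕ} {x : ℕ → ℝ}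

/-- Uniformity in `w` matters: the induction over blocks keeps `w` fixed while `k` grows. Once `m ≥
S`, the bound `w * 2 ^ k ≤ S` gives the required `w * R ≤ 1`. -/
theorem eventually_block_estimate (hek : ∀ k, e k ≤ k) (he : Tendsto e atTop atTop)
    (hx : ∀ k, ∀ l < 2 ^ e k,
      IsLayer (2 ^ e k) (2 ^ (2 * e k)) (2 ^ (k - e k)) l (2 ^ k + l * 2 ^ (k - e k)) x)
    (herr : ∀ᶠ k in atTop,
      layerError (2 ^ e k) ((2 ^ e k) ^ 2) * ((2 ^ e k : ℕ) : ℝ) ^ 2 ≤ 2 ^ k)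
    (S ε : ℝ) (hε : 0 < ε) :
    ∀ᶠ k in atTop, ∀ w, 0 ≤ w → w * 2 ^ k ≤ S → ∀ l ≤ 2 ^ e k,
      |closePairs x (2 ^ k + l * 2 ^ (k - e k)) w - 2 * w * (2 ^ k + l * 2 ^ (k - e k)) ^ 2|
        ≤ |closePairs x (2 ^ k) w - 2 * w * (2 ^ k) ^ 2| + ε * 2 ^ k := by
  have hpow : Tendsto (fun k => (2 : ℝ) ^ e k) atTop atTop :=
    (tendsto_pow_atTop_atTop_of_one_lt one_lt_two).comp he
  have hpow' : Tendsto (fun k : ℕ => (2 : ℝ) ^ k) atTop atTop :=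
    tendsto_pow_atTop_atTop_of_one_lt one_lt_two
  filter_upwards [herr, hpow.eventually_ge_atTop S, hpow'.eventually_ge_atTop (2 * S),
    hpow.eventually_ge_atTop ((7 + 4 * S) / ε)] with k h1 h2 h3 h4 w hw hwS l hl
  have hmR : 2 ^ e k * 2 ^ (k - e k) = 2 ^ k := by
    rw [← pow_add, Nat.add_sub_cancel' (hek k)]
  have hmR' : (2 : ℝ) ^ e k * 2 ^ (k - e k) = 2 ^ k := by
    rw [← pow_add, Nat.add_sub_cancel' (hek k)]
  have hm : (0 : ℝ) < 2 ^ e k := by positivity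
  have hk : (0 : ℝ) < 2 ^ k := by positivity
  have hwR : w * 2 ^ (k - e k) ≤ 1 := by
    rw [← hmR'] at hwS
    by_contra h
    push Not at h
    nlinarith
  have hw2 : 2 * w ≤ 1 := by
    by_contra h
    push Not at h
    nlinarith
  have h := abs_closePairs_sub_le_of_layers (2 ^ e k) (2 ^ (k - e k)) (by positivity) x
    (by rw [hmR, ← pow_mul, mul_comm (e k)]; exact hx k)
    (by push_cast at h1 ⊢; rw [hmR']; exact h1) w hw (by push_cast; exact hwR) hw2 l hl
  rw [hmR] at h
  push_cast at h
  rw [hmR'] at h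
  refine h.trans ?_
  gcongr
  rw [div_le_iff₀ hε] at h4
  rw [div_le_iff₀ hm]
  nlinarith

/-- A block doubles the length while adding little error, so the relative error `a` becomes at most
`a / 2 + ε / 4`. The initial error decays geometrically and `ε / 2` is the fixed point. -/
theorem eventually_abs_closePairs_two_pow_sub_le (hek : ∀ k, e k ≤ k)
    (he : Tendsto e atTop atTop)
    (hx : ∀ k, ∀ l < 2 ^ e k,
      IsLayer (2 ^ e k) (2 ^ (2 * e k)) (2 ^ (k - e k)) l (2 ^ k + l * 2 ^ (k - e k)) x)
    (herr : ∀ᶠ k in atTop,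
      layerError (2 ^ e k) ((2 ^ e k) ^ 2) * ((2 ^ e k : ℕ) : ℝ) ^ 2 ≤ 2 ^ k)
    (S ε : ℝ) (hε : 0 < ε) :
    ∀ᶠ k in atTop, ∀ w, 0 ≤ w → w * 2 ^ k ≤ S →
      |closePairs x (2 ^ k) w - 2 * w * (2 ^ k) ^ 2| ≤ ε * 2 ^ k := by
  obtain ⟨k₀, hk₀⟩ := eventually_atTop.1
    (eventually_block_estimate hek he hx herr S (ε / 2) (by positivity))
  -- Trivial bound at the start: at most `(2 ^ k₀) ^ 2` pairs, and a main term of at most `2 * |S| *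
  -- 2 ^ k₀`.
  set A : ℝ := 2 ^ k₀ + 2 * |S| with hA
  have key : ∀ r : ℕ, ∀ w, 0 ≤ w → w * 2 ^ (k₀ + r) ≤ S →
      |closePairs x (2 ^ (k₀ + r)) w - 2 * w * (2 ^ (k₀ + r)) ^ 2|
        ≤ (A / 2 ^ r + ε / 2) * 2 ^ (k₀ + r) := by
    intro r
    induction r with
    | zero =>
      intro w hw hwS
      simp only [add_zero, pow_zero, div_one] at hwS ⊢
      have h1 := closePairs_nonneg x (2 ^ k₀) w
      have h2 := closePairs_le_sq x (2 ^ k₀) w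
      push_cast at h2
      have h3 : (0 : ℝ) < 2 ^ k₀ := by positivity
      have h4 := le_abs_self S
      have h5 : 2 * w * (2 ^ k₀) ^ 2 ≤ 2 * |S| * 2 ^ k₀ := by nlinarith
      have h6 : 0 ≤ 2 * w * (2 ^ k₀) ^ 2 := by positivity
      have h7 : 0 ≤ |S| * 2 ^ k₀ := by positivity
      have h8 : 0 ≤ ε * 2 ^ k₀ := by positivity
      rw [abs_le, hA]
      constructor <;> nlinarith
    | succ r ih =>
      intro w hw hwS
      have hp : (2 : ℝ) ^ (k₀ + (r + 1)) = 2 * 2 ^ (k₀ + r) := by rw [← add_assoc, pow_succ]; ring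
      have hp0 : (0 : ℝ) < 2 ^ (k₀ + r) := by positivity
      have hwS' : w * 2 ^ (k₀ + r) ≤ S := by
        rw [hp] at hwS
        have : 0 ≤ w * 2 ^ (k₀ + r) := by positivity
        linarith
      have h1 := ih w hw hwS'
      have h2 := hk₀ (k₀ + r) (by omega) w hw hwS' (2 ^ e (k₀ + r)) le_rfl
      have e1 : 2 ^ (k₀ + r) + 2 ^ e (k₀ + r) * 2 ^ (k₀ + r - e (k₀ + r)) = 2 ^ (k₀ + (r + 1)) := by
        rw [← pow_add, Nat.add_sub_cancel' (hek _), ← add_assoc, pow_succ]; ring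
      have e2 : (2 : ℝ) ^ (k₀ + r) + ((2 ^ e (k₀ + r) : ℕ) : ℝ) * 2 ^ (k₀ + r - e (k₀ + r))
          = 2 ^ (k₀ + (r + 1)) := by
        exact_mod_cast e1
      rw [e1, e2] at h2
      refine h2.trans ?_
      have e3 : (A / 2 ^ (r + 1) + ε / 2) * 2 ^ (k₀ + (r + 1))
          = (A / 2 ^ r + ε / 2) * 2 ^ (k₀ + r) + ε / 2 * 2 ^ (k₀ + r) := by
        rw [hp, pow_succ]; field_simp; ring
      rw [e3]
      linarith
  have hlim : Tendsto (fun r : ℕ => A / (2 : ℝ) ^ r) atTop (𝓝 0) :=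
    tendsto_const_nhds.div_atTop (tendsto_pow_atTop_atTop_of_one_lt one_lt_two)
  obtain ⟨r₀, hr₀⟩ := eventually_atTop.1 (hlim.eventually_le_const (half_pos hε))
  refine eventually_atTop.2 ⟨k₀ + r₀, fun k hk w hw hwS => ?_⟩
  obtain ⟨r, rfl⟩ := Nat.exists_eq_add_of_le (by omega : k₀ ≤ k)
  refine (key r w hw hwS).trans ?_
  have := hr₀ r (by omega)
  gcongr
  linarith

/-- With `w = s / N` fixed, monotonicity squeezes the count at `N` between those at the adjacent
layer boundaries, whose distance `R` is `o(N)`. -/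
theorem tendsto_closePairs_div (hek : ∀ k, e k ≤ k) (he : Tendsto e atTop atTop)
    (hx : ∀ k, ∀ l < 2 ^ e k,
      IsLayer (2 ^ e k) (2 ^ (2 * e k)) (2 ^ (k - e k)) l (2 ^ k + l * 2 ^ (k - e k)) x)
    (herr : ∀ᶠ k in atTop,
      layerError (2 ^ e k) ((2 ^ e k) ^ 2) * ((2 ^ e k : ℕ) : ℝ) ^ 2 ≤ 2 ^ k)
    (s : ℝ) (hs : 0 < s) :
    Tendsto (fun N : ℕ => closePairs x N (s / N) / N) atTop (𝓝 (2 * s)) := by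
  have hpow : Tendsto (fun k => (2 : ℝ) ^ e k) atTop atTop :=
    (tendsto_pow_atTop_atTop_of_one_lt one_lt_two).comp he
  rw [Metric.tendsto_nhds]
  intro ε hε
  have hlog : Tendsto (Nat.log 2) atTop atTop := by
    refine tendsto_atTop.2 fun b => eventually_atTop.2 ⟨2 ^ b, fun N hN => ?_⟩
    exact Nat.le_log_of_pow_le (by norm_num) hN
  -- Budget: two errors of `ε * N / 16`, and at most `6 * s * R ≤ 6 * ε * N / 16` from moving to a
  -- layer boundary.
  have ev1 := hlog.eventually (eventually_block_estimate hek he hx herr s (ε / 16) (by positivity))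
  have ev2 := hlog.eventually
    (eventually_abs_closePairs_two_pow_sub_le hek he hx herr s (ε / 16) (by positivity))
  have ev3 := hlog.eventually (hpow.eventually_ge_atTop (16 * s / ε))
  filter_upwards [ev1, ev2, ev3, eventually_ge_atTop 1] with N h1 h2 h3 hN
  set k := Nat.log 2 N with hk
  have hN0 : N ≠ 0 := by omega
  have hkN : 2 ^ k ≤ N := Nat.pow_log_le_self 2 hN0
  have hNk : N < 2 ^ (k + 1) := Nat.lt_pow_succ_log_self (by norm_num) N
  set R := 2 ^ (k - e k) with hR
  have hRpos : 0 < R := by positivity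
  have hmR : 2 ^ e k * R = 2 ^ k := by
    rw [hR, ← pow_add, Nat.add_sub_cancel' (hek k)]
  set l := (N - 2 ^ k) / R with hl
  have hlm : l + 1 ≤ 2 ^ e k := by
    rw [Nat.add_one_le_iff, hl, Nat.div_lt_iff_lt_mul hRpos, hmR]
    rw [pow_succ] at hNk
    omega
  have hlN : 2 ^ k + l * R ≤ N := by
    have := Nat.div_mul_le_self (N - 2 ^ k) R
    rw [← hl] at this
    omega
  have hNl : N ≤ 2 ^ k + (l + 1) * R := by
    have := Nat.lt_div_mul_add (a := N - 2 ^ k) hRpos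
    rw [← hl] at this
    have e' : (l + 1) * R = l * R + R := by ring
    omega
  have hN' : (0 : ℝ) < N := by exact_mod_cast hN
  have hkN' : (2 : ℝ) ^ k ≤ N := by exact_mod_cast hkN
  have hw : (0 : ℝ) ≤ s / N := by positivity
  have hwS : s / N * 2 ^ k ≤ s := by
    rw [div_mul_eq_mul_div, div_le_iff₀ hN']
    gcongr
  have h2' := h2 _ hw hwS
  have lo := h1 _ hw hwS l (by omega)
  have up := h1 _ hw hwS (l + 1) hlm
  have mlo := closePairs_mono x hlN (s / N)
  have mup := closePairs_mono x hNl (s / N)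
  have hRN : (R : ℝ) * (16 * s) ≤ ε * N := by
    rw [div_le_iff₀ hε] at h3
    have e1 : (2 : ℝ) ^ e k * R = 2 ^ k := by exact_mod_cast hmR
    have : (R : ℝ) * (16 * s) ≤ R * (2 ^ e k * ε) := by gcongr
    nlinarith
  have hRN' : (R : ℝ) ≤ N := by
    have : R ≤ 2 ^ k := Nat.pow_le_pow_right (by norm_num) (by omega)
    exact_mod_cast this.trans hkN
  set a : ℝ := 2 ^ k + l * R with ha
  have hRcast : ((2 : ℝ) ^ (k - e k)) = R := by rw [hR]; push_cast; rfl
  have e2 : (2 : ℝ) ^ k + ((l + 1 : ℕ) : ℝ) * 2 ^ (k - e k) = a + R := by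
    rw [hRcast, ha]; push_cast; ring
  have e3 : (2 : ℝ) ^ k + (l : ℝ) * 2 ^ (k - e k) = a := by rw [hRcast]
  rw [e2] at up
  rw [e3] at lo
  have haN : a ≤ N := by rw [ha]; exact_mod_cast hlN
  have hNa : (N : ℝ) ≤ a + R := by
    have : (N : ℝ) ≤ ((2 ^ k + (l + 1) * R : ℕ) : ℝ) := by exact_mod_cast hNl
    push_cast at this
    rw [ha]; linarith
  have ha0 : 0 ≤ a := by positivity
  have hεk : ε / 16 * 2 ^ k ≤ ε / 16 * N := by gcongr
  have lo' := (abs_le.1 lo).1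
  have up' := (abs_le.1 up).2
  have q1 : 2 * (s / N) * N ^ 2 = 2 * s * N := by field_simp
  have hsN : s / N * N = s := by field_simp
  have q2 : 2 * (s / N) * (a + R) ^ 2 ≤ 2 * s * N + 6 * s * R := by
    have : 2 * (s / N) * (a + R) ^ 2 ≤ 2 * (s / N) * (N ^ 2 + 3 * N * R) := by
      gcongr
      nlinarith
    have e : 2 * (s / N) * (N ^ 2 + 3 * N * R) = 2 * s * N + 6 * s * R := by field_simp; ring
    linarith
  have q3 : 2 * s * N - 4 * s * R ≤ 2 * (s / N) * a ^ 2 := by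
    have : 2 * (s / N) * (N ^ 2 - 2 * N * R) ≤ 2 * (s / N) * a ^ 2 := by
      gcongr
      nlinarith
    have e : 2 * (s / N) * (N ^ 2 - 2 * N * R) = 2 * s * N - 4 * s * R := by field_simp; ring
    linarith
  have hεN : 0 < ε * N := by positivity
  have hsR : 0 ≤ s * R := by positivity
  rw [Real.dist_eq, div_sub' hN'.ne', abs_div, abs_of_pos hN', div_lt_iff₀ hN', abs_lt]
  constructor <;> linarith

end

/-! ### Gap lengths -/

/-- A gap longer than `2 / R` between consecutive terms would contain a whole cell, hence a term
strictly between neighbours. -/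
theorem torusNorm_gap_le {N : ℕ} (y : Fin N → ℝ) (σ : Equiv.Perm (Fin N))
    (hσ : Monotone (y ∘ σ)) (R : ℕ) (hR : 0 < R) (hy : ∀ i, 0 ≤ y i ∧ y i < 1)
    (hcell : ∀ b < R, ∃ i, (b : ℝ) / R ≤ y i ∧ y i < (b + 1) / R) (k : Fin N) :
    torusNorm (y (σ (finRotate N k)) - y (σ k)) ≤ 2 / R := by
  have hR' : (0 : ℝ) < R := by exact_mod_cast hR
  obtain _ | n := N
  · exact k.elim0
  by_cases hk : (k : ℕ) < n
  · have hrot : finRotate (n + 1) k = ⟨k + 1, by omega⟩ := finRotate_of_lt hk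
    rw [hrot]
    set v := y (σ ⟨k + 1, by omega⟩) with hv
    set u := y (σ k) with hu
    have huv : u ≤ v := hσ (Fin.le_def.2 (by simp) : k ≤ ⟨k + 1, by omega⟩)
    refine (torusNorm_le_abs_sub _ 0).trans ?_
    rw [Int.cast_zero, sub_zero, abs_of_nonneg (sub_nonneg.2 huv)]
    by_contra hlt
    push Not at hlt
    rw [div_lt_iff₀ hR'] at hlt
    have hu0 : 0 ≤ u := (hy _).1
    have hv1 : v < 1 := (hy _).2
    have h1 := Nat.floor_le (by positivity : 0 ≤ u * R)
    have h2 := Nat.lt_floor_add_one (u * R)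
    have h3 : ⌊u * R⌋₊ + 1 < R := by
      have : ((⌊u * R⌋₊ + 1 : ℕ) : ℝ) < R := by push_cast; nlinarith
      exact_mod_cast this
    obtain ⟨i, hi1, hi2⟩ := hcell _ h3
    push_cast at hi1 hi2
    rw [div_le_iff₀ hR'] at hi1
    rw [lt_div_iff₀ hR'] at hi2
    have hui : u < y i := lt_of_mul_lt_mul_right (h2.trans_le hi1) hR'.le
    have hiv : y i < v := by
      refine lt_of_mul_lt_mul_right (hi2.trans ?_) hR'.le
      nlinarith
    obtain ⟨j, rfl⟩ := σ.surjective i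
    rcases le_or_gt j k with h | h
    · exact (hσ h).not_gt hui
    · exact (hσ (Fin.le_def.2 (by simpa using h) : (⟨k + 1, by omega⟩ : Fin (n + 1)) ≤ j)).not_gt hiv
  -- The wrap-around gap: the least term is in the first cell and the greatest in the last, so
  -- shifting by one period gives the bound.
  · have hkn : k = Fin.last n := Fin.ext (by simp; omega)
    rw [hkn, finRotate_last]
    obtain ⟨i, -, hi⟩ := hcell 0 hR
    obtain ⟨j, hj, -⟩ := hcell (R - 1) (by omega)
    obtain ⟨i, rfl⟩ := σ.surjective i
    obtain ⟨j, rfl⟩ := σ.surjective j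
    have h1 : y (σ 0) ≤ y (σ i) := hσ (Fin.zero_le i)
    have h2 : y (σ j) ≤ y (σ (Fin.last n)) := hσ (Fin.le_last j)
    have h3 := (hy (σ 0)).1
    have h4 := (hy (σ (Fin.last n))).2
    refine (torusNorm_le_abs_sub _ (-1)).trans ?_
    have h5 : (((R - 1 : ℕ) : ℝ)) / R = 1 - 1 / R := by
      rw [Nat.cast_sub hR, Nat.cast_one]; field_simp
    rw [h5] at hj
    have h6 : (2 : ℝ) / R = 1 / R + 1 / R := by ring
    have h7 : (((0 : ℕ) : ℝ) + 1) / R = 1 / R := by simp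
    rw [h7] at hi
    push_cast
    rw [abs_of_nonneg (by linarith), h6]
    linarith

theorem exists_torusNorm_grid_eq (G : ℕ) (hG : 0 < G) (a b : ℤ) :
    ∃ q : ℕ, torusNorm ((a : ℝ) / G - (b : ℝ) / G) = q / G := by
  have hG' : (0 : ℝ) < G := by exact_mod_cast hG
  refine ⟨(a - b - round ((a : ℝ) / G - (b : ℝ) / G) * G).natAbs, ?_⟩
  rw [torusNorm, UnitAddCircle.norm_eq, Nat.cast_natAbs, eq_div_iff hG'.ne']
  generalize round ((a : ℝ) / G - (b : ℝ) / G) = r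
  have h : ((a - b - r * G : ℤ) : ℝ) = ((a : ℝ) / G - (b : ℝ) / G - r) * G := by
    push_cast; field_simp
  rw [Int.cast_abs, h, abs_mul, abs_of_pos hG']

/-- Every gap is `q / G` with `q` natural, and `q / G ≤ 2 / R` forces `q ≤ D`. -/
theorem gapCount_le (x : ℕ+ → ℝ) (N : ℕ+) (R D G : ℕ) (hR : 0 < R) (hG : 0 < G) (hD : 2 * G ≤ D * R)
    (hgrid : ∀ i, ∃ p : ℤ, (0 ≤ p ∧ p < G) ∧ initialTerms x N i = (p : ℝ) / G)
    (hcell : ∀ b < R, ∃ i, (b : ℝ) / R ≤ initialTerms x N i ∧ initialTerms x N i < (b + 1) / R) :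
    gapCount x N ≤ D + 1 := by
  have hR' : (0 : ℝ) < R := by exact_mod_cast hR
  have hG' : (0 : ℝ) < G := by exact_mod_cast hG
  have hsub : gapSet x N ⊆ ((Finset.range (D + 1)).image fun q : ℕ => (q : ℝ) / G : Finset ℝ) := by
    rintro r ⟨σ, hσ, k, rfl⟩
    have hle := torusNorm_gap_le (initialTerms x N) σ hσ R hR (fun i => by
      obtain ⟨p, ⟨h0, h1⟩, hp⟩ := hgrid i
      rw [hp, div_lt_one hG']
      have : (0 : ℝ) ≤ p := by exact_mod_cast h0
      exact ⟨by positivity, by exact_mod_cast h1⟩) hcell k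
    obtain ⟨p, -, hp⟩ := hgrid (σ (finRotate N k))
    obtain ⟨p', -, hp'⟩ := hgrid (σ k)
    rw [hp, hp'] at hle ⊢
    obtain ⟨q, hq⟩ := exists_torusNorm_grid_eq G hG p p'
    rw [hq] at hle ⊢
    rw [Finset.mem_coe, Finset.mem_image]
    refine ⟨q, ?_, rfl⟩
    rw [div_le_div_iff₀ hG' hR'] at hle
    have h1 : q * R ≤ 2 * G := by exact_mod_cast hle
    have := Nat.le_of_mul_le_mul_right (h1.trans hD) hR
    rw [Finset.mem_range]; omega
  calc gapCount x N ≤ ((Finset.range (D + 1)).image fun q : ℕ => (q : ℝ) / G : Finset ℝ).card := by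
        rw [← Set.ncard_coe_finset]
        exact Set.ncard_le_ncard hsub (Finset.finite_toSet _)
    _ ≤ D + 1 := Finset.card_image_le.trans (by simp)

/-! ### Positive indices, choice of parameters, conclusion -/

theorem pairCorrelation_natPred (x : ℕ → ℝ) (N : ℕ+) (s : ℝ) :
    pairCorrelation (fun n => x n.natPred) N s = closePairs x N (s / N) / N := by
  classical
  rw [pairCorrelation, closePairs_eq_card, ← Set.ncard_coe_finset]
  congr 2
  refine Set.ncard_congr (fun q _ => (q.1.natPred, q.2.natPred)) ?_ ?_ ?_
  · rintro ⟨i, j⟩ ⟨hi, hj, hij, h⟩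
    simp only [Finset.coe_filter, Finset.mem_product, Finset.mem_range, Set.mem_ofPred_eq]
    have h1 := PNat.natPred_add_one i
    have h2 := PNat.natPred_add_one j
    have hi' : (i : ℕ) ≤ N := hi
    have hj' : (j : ℕ) ≤ N := hj
    exact ⟨⟨by omega, by omega⟩, fun e => hij (PNat.natPred_injective e), h⟩
  · rintro ⟨i, j⟩ ⟨i', j'⟩ - - h
    simp only [Prod.mk.injEq] at h
    rw [PNat.natPred_injective h.1, PNat.natPred_injective h.2]
  · rintro ⟨i, j⟩ h
    simp only [Finset.coe_filter, Finset.mem_product, Finset.mem_range, Set.mem_ofPred_eq] at h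
    refine ⟨(i.succPNat, j.succPNat), ⟨?_, ?_, ?_, ?_⟩, by simp⟩
    · exact PNat.coe_le_coe _ _ |>.1 (by simpa using h.1.1)
    · exact PNat.coe_le_coe _ _ |>.1 (by simpa using h.1.2)
    · intro e
      exact h.2.1 (Nat.succPNat_injective e)
    · simpa using h.2.2

/-- The terms lie on the grid of block `k + 1`, whereas layer 0 of block `k`, already complete,
fills the cells. Hence `2 * G / R = 2 ^ (3 + 2 * e (k + 1) + e k)`. -/
theorem gapCount_natPred_le {e : ℕ → ℕ} {x : ℕ → ℝ} (he : Monotone e) (hek : ∀ k, e k ≤ k)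
    (hx : ∀ k, DistinctOnGrid (2 ^ (k + 1 + 2 * e k)) x (2 ^ (k + 1)) ∧
      ∀ l < 2 ^ e k,
        IsLayer (2 ^ e k) (2 ^ (2 * e k)) (2 ^ (k - e k)) l (2 ^ k + l * 2 ^ (k - e k)) x)
    (k : ℕ) (N : ℕ+) (hkN : 2 ^ (k + 1) ≤ (N : ℕ)) (hNk : (N : ℕ) < 2 ^ (k + 1 + 1)) :
    gapCount (fun n => x n.natPred) N ≤ 2 ^ (3 + 3 * e (k + 1)) + 1 := by
  have hmono : e k ≤ e (k + 1) := he (Nat.le_succ k)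
  have hterm : ∀ i : Fin (N : ℕ), initialTerms (fun n => x n.natPred) N i = x i := fun i => by
    simp [initialTerms]
  refine gapCount_le _ N (2 ^ (k - e k)) _ (2 ^ (k + 1 + 1 + 2 * e (k + 1))) (by positivity)
    (by positivity) ?_ (fun i => ?_) (fun b hb => ?_)
  · rw [← pow_succ', ← pow_add]
    refine Nat.pow_le_pow_right (by norm_num) ?_
    have := hek k
    omega
  · rw [hterm]
    exact (hx (k + 1)).1.1 i (i.2.trans hNk)
  · obtain ⟨i, hi, h⟩ := ((hx k).2 0 (by positivity)).1 b hb
    have hlen : 2 ^ (k - e k) ≤ 2 ^ k := Nat.pow_le_pow_right (by norm_num) (by omega)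
    have hlt : 2 ^ k + 0 * 2 ^ (k - e k) + b < N := by
      rw [pow_succ] at hkN; omega
    refine ⟨⟨_, hlt⟩, ?_⟩
    rw [hterm, h]
    have hs : ((site (2 ^ e k) 0 i : ℕ) : ℝ) < (2 * 2 ^ (2 * e k) * 2 ^ e k : ℕ) := by
      exact_mod_cast site_lt (by positivity) hi
    generalize site (2 ^ e k) 0 i = c at hs
    have hE : (0 : ℝ) < (2 * 2 ^ (2 * e k) * 2 ^ e k : ℕ) := by
      have : 0 < 2 * 2 ^ (2 * e k) * 2 ^ e k := by positivity
      exact_mod_cast this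
    generalize 2 * 2 ^ (2 * e k) * 2 ^ e k = E at hs hE
    have hR : (0 : ℝ) < (2 ^ (k - e k) : ℕ) := by
      have : 0 < 2 ^ (k - e k) := by positivity
      exact_mod_cast this
    generalize 2 ^ (k - e k) = R at hR
    push_cast
    constructor
    · rw [div_le_div_iff₀ hR (by positivity)]
      have : (0 : ℝ) ≤ c * R := by positivity
      nlinarith
    · rw [div_lt_div_iff₀ (by positivity) hR]
      nlinarith

/-- Any sequence of thresholds is respected by a slowly growing choice of parameters. -/
theorem exists_slow_parameter (t : ℕ → ℕ) :
    ∃ e : ℕ → ℕ, Monotone e ∧ (∀ k, e k ≤ k) ∧ Tendsto e atTop atTop ∧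
      ∀ᶠ k in atTop, t (e k) ≤ k := by
  refine ⟨fun k => Nat.findGreatest (fun j => t j ≤ k) k, fun a b hab => ?_,
    fun k => Nat.findGreatest_le k, tendsto_atTop.2 fun b => ?_, ?_⟩
  · exact Nat.findGreatest_mono (fun j hj => le_trans hj hab) hab
  · filter_upwards [eventually_ge_atTop b, eventually_ge_atTop (t b)] with k h1 h2
    exact Nat.le_findGreatest h1 h2
  -- From `t 0` on, `j = 0` qualifies, so the default value of `Nat.findGreatest` plays no role.
  · filter_upwards [eventually_ge_atTop (t 0)] with k hk
    exact Nat.findGreatest_spec (P := fun j => t j ≤ k) (Nat.zero_le k) hk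

theorem theorem3 (f : ℕ+ → ℕ+) (hf : Tendsto f atTop atTop) :
    ∃ x : ℕ+ → ℝ, (∀ n : ℕ+, x n ∈ Set.Ico (0 : ℝ) 1) ∧
      HasPoissonianPairCorrelations x ∧
      ∀ᶠ n : ℕ+ in atTop, gapCount x n ≤ (f n : ℕ) := by
  have hpow : Tendsto (fun k : ℕ => (2 : ℝ) ^ k) atTop atTop :=
    tendsto_pow_atTop_atTop_of_one_lt one_lt_two
  -- One threshold for both demands on the parameter value `j`: a negligible layer error, and a gap
  -- bound below `f`.
  have ht : ∀ j : ℕ, ∃ t : ℕ, ∀ k ≥ t,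
      layerError (2 ^ j) ((2 ^ j) ^ 2) * ((2 ^ j : ℕ) : ℝ) ^ 2 ≤ 2 ^ k ∧
      ∀ N : ℕ+, k ≤ N → 2 ^ (3 + 3 * j) + 1 ≤ (f N : ℕ) := by
    intro j
    obtain ⟨t₁, h₁⟩ := eventually_atTop.1 (hpow.eventually_ge_atTop
      (layerError (2 ^ j) ((2 ^ j) ^ 2) * ((2 ^ j : ℕ) : ℝ) ^ 2))
    obtain ⟨t₂, h₂⟩ := eventually_atTop.1 (hf.eventually_ge_atTop (Nat.succPNat (2 ^ (3 + 3 * j))))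
    refine ⟨max t₁ t₂, fun k hk => ⟨h₁ k (le_of_max_le_left hk), fun N hN => ?_⟩⟩
    have h : t₂ ≤ N := PNat.coe_le_coe _ _ |>.1 ((le_of_max_le_right hk).trans hN)
    have := PNat.coe_le_coe _ _ |>.2 (h₂ N h)
    simpa using this
  choose t ht using ht
  obtain ⟨e, hmono, hek, he, hte⟩ := exists_slow_parameter t
  obtain ⟨x, hx⟩ := exists_layered_sequence e hmono hek
  have herr : ∀ᶠ k in atTop,
      layerError (2 ^ e k) ((2 ^ e k) ^ 2) * ((2 ^ e k : ℕ) : ℝ) ^ 2 ≤ 2 ^ k :=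
    hte.mono fun k hk => (ht (e k) k hk).1
  refine ⟨fun n => x n.natPred, fun n => ?_, fun s hs => ?_, ?_⟩
  · have hlt : n.natPred < 2 ^ (n.natPred + 1) :=
      Nat.lt_two_pow_self.trans (Nat.pow_lt_pow_right (by norm_num) (by omega))
    obtain ⟨p, ⟨h0, h1⟩, hp⟩ := (hx n.natPred).1.1 _ hlt
    have h0' : (0 : ℝ) ≤ p := by exact_mod_cast h0
    have h1' : (p : ℝ) < (2 ^ (n.natPred + 1 + 2 * e n.natPred) : ℕ) := by exact_mod_cast h1
    simp only [hp]
    exact ⟨by positivity, (div_lt_one (h0'.trans_lt h1')).2 h1'⟩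
  · simp_rw [pairCorrelation_natPred]
    exact (tendsto_closePairs_div hek he (fun k => (hx k).2) herr s hs).comp
      (tendsto_atTop.2 fun b => eventually_atTop.2
        ⟨Nat.succPNat b, fun N hN => by
          have : b + 1 ≤ (N : ℕ) := by simpa using PNat.coe_le_coe _ _ |>.2 hN
          omega⟩)
  · obtain ⟨k₀, hk₀⟩ := eventually_atTop.1 hte
    refine eventually_atTop.2 ⟨Nat.succPNat (2 ^ (k₀ + 1)), fun N hN => ?_⟩
    have hN' : 2 ^ (k₀ + 1) + 1 ≤ (N : ℕ) := by simpa using PNat.coe_le_coe _ _ |>.2 hN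
    have hk : k₀ + 1 ≤ Nat.log 2 N := Nat.le_log_of_pow_le (by norm_num) (by omega)
    obtain ⟨k, hk'⟩ := Nat.exists_eq_add_of_le' (by omega : 1 ≤ Nat.log 2 N)
    have h1 : 2 ^ (k + 1) ≤ (N : ℕ) := by
      rw [← hk']; exact Nat.pow_log_le_self 2 N.ne_zero
    have h2 : (N : ℕ) < 2 ^ (k + 1 + 1) := by
      rw [← hk']; exact Nat.lt_pow_succ_log_self (by norm_num) N
    refine (gapCount_natPred_le hmono hek hx k N h1 h2).trans ?_
    exact (ht (e (k + 1)) (k + 1) (hk₀ _ (by omega))).2 N (Nat.lt_two_pow_self.le.trans h1)
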